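/- Let $(e_i)_{i\ge 0}$ be the orthonormal basis $e_0=1$, $e_i(\theta)=\sqrt2\cos(i\pi\theta)$ $(i\ge1)$ of $L^2(0,1)$, and let $Q$ be the operator with $Qe_0=0$ and $Qe_i=(i\pi)^{-2}e_i$ for $i\ge1$ (the inverse of minus the Neumann Laplacian on mean-zero functions). For $c>0$ let $\mu_c=\mathcal N(c\,e_0,Q)$ be the Gaussian measure on $L^2(0,1)$ with mean $c\,e_0$ and covariance $Q$, and let $K=\{x\in L^2(0,1): x\ge0 \text{ a.e.}\}$. Write $x^+=\max(x,0)$ and $x^-=\max(-x,0)$. Consider one of the following two cases, with $n\ge1$ an integer and $x\in\mathbb R$. (Logarithmic case.) $F^n(x)=(x+\tfrac1n)\ln(x^++\tfrac1n)-x^++1-\tfrac1n$, and $F(x)=x\ln x-x+1$ for $x\ge0$ (with $0\ln0=0$). (Negative-power case, $\alpha>0$.) If $\alpha\ne1$, $F^n(x)=\frac{(x^++1/n)^{1-\alpha}}{\alpha-1}+n^\alpha x^-$ and $F(x)=\frac{x^{1-\alpha}}{\alpha-1}$ for $x>0$; if $\alpha=1$, $F^n(x)=-\ln(x^++\tfrac1n)+n\,x^-$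 and $F(x)=-\ln x$ for $x>0$; in both cases $F(0)=\lim_{x\downarrow0}F(x)\in(-\infty,+\infty]$. For $x\in L^2(0,1)$ put $U^n(x)=\int_0^1F^n(x(\theta))\,d\theta$, and $U(x)=\int_0^1F(x(\theta))\,d\theta$ if $x\in K$ and $\int_0^1|F(x(\theta))|\,d\theta<\infty$, $U(x)=+\infty$ otherwise (in the logarithmic case the integral is finite for every $x\in K$). Then, in each case and for every $c>0$, the constants $Z_c^n=\int e^{-U^n}d\mu_c$ $(n\ge1)$ and $Z_c=\int e^{-U}\mathbf 1_K\,d\mu_c$ are positive and finite, so that $$\nu_c^n(dx)=\frac1{Z_c^n}e^{-U^n(x)}\mu_c(dx),\qquad \nu_c(dx)=\frac1{Z_c}e^{-U(x)}\mathbf 1_{x\in K}\,\mu_c(dx)$$ are Borel probability measures on $L^2(0,1)$, and $\nu_c^n$ converges weakly to $\nu_c$ as $n\to+\infty$. -/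

import Mathlib

open MeasureTheory ProbabilityTheory Filter Topology
open scoped ENNReal

namespace CahnHilliard

/-- Lebesgue measure on the interval `(0,1)`. -/
noncomputable abbrev leb : Measure ℝ := volume.restrict (Set.Ioo (0 : ℝ) 1)

instance instIsProbabilityMeasureLeb : IsProbabilityMeasure leb := ⟨by simp [leb]⟩

/-- The Hilbert space `L²(0,1)`, with its Borel σ-algebra. -/
noncomputable abbrev L2 : Type := Lp ℝ 2 leb

noncomputable instance instMeasurableSpaceL2 : MeasurableSpace L2 := borel L2

instance instBorelSpaceL2 : BorelSpace L2 := ⟨rfl⟩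

/-- `e₀ = 1` and `eᵢ(θ) = √2 cos(iπθ)` for `i ≥ 1`: the Neumann eigenfunctions on `(0,1)`, as
functions. -/
noncomputable def eFun (i : ℕ) (θ : ℝ) : ℝ :=
  if i = 0 then 1 else √2 * Real.cos (i * Real.pi * θ)

lemma continuous_eFun (i : ℕ) : Continuous (eFun i) := by
  unfold eFun
  split_ifs <;> fun_prop

lemma memLp_eFun (i : ℕ) : MemLp (eFun i) 2 leb := by
  refine MemLp.of_bound (continuous_eFun i).aestronglyMeasurable 2 (ae_of_all _ fun θ => ?_)
  unfold eFun
  split_ifs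
  · simp
  · rw [norm_mul, Real.norm_eq_abs, Real.norm_eq_abs, abs_of_nonneg (Real.sqrt_nonneg 2)]
    have h2 : √2 ≤ 2 := Real.sqrt_le_iff.2 (by norm_num)
    nlinarith [Real.abs_cos_le_one (i * Real.pi * θ), abs_nonneg (Real.cos (i * Real.pi * θ)),
      Real.sqrt_nonneg 2]

/-- The Neumann eigenfunctions as elements of `L²(0,1)`. -/
noncomputable def e (i : ℕ) : L2 := (memLp_eFun i).toLp (eFun i)

/-- The law of a sequence of independent standard normal random variables. -/
noncomputable def stdNormalSeq : Measure (ℕ → ℝ) := Measure.infinitePi fun _ => gaussianReal 0 1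

/-- The random series `c e₀ + ∑_{i ≥ 1} (ξᵢ / (iπ)) eᵢ`, which converges in `L²(0,1)` for almost
every sequence `ξ`. -/
noncomputable def gaussianSeries (c : ℝ) (ξ : ℕ → ℝ) : L2 :=
  c • e 0 + ∑' i : ℕ, (ξ i / ((i + 1 : ℝ) * Real.pi)) • e (i + 1)

/-- The Gaussian measure `μ_c = N(c e₀, Q)` on `L²(0,1)`, where `Q` is the inverse of minus the
Neumann Laplacian on mean-zero functions and `Q e₀ = 0`, that is, `Q eᵢ = (iπ)⁻² eᵢ` for `i ≥ 1`.
See `charFun_mu` for its characteristic function. -/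
noncomputable def mu (c : ℝ) : Measure L2 := stdNormalSeq.map (gaussianSeries c)

/-- The antiderivative `Fⁿ` of `-fⁿ` in the logarithmic case, with `fⁿ(x) = -log (x⁺ + 1/n)`. -/
noncomputable def FnLog (n : ℕ) (x : ℝ) : ℝ :=
  (x + 1 / n) * Real.log (x⁺ + 1 / n) - x⁺ + 1 - 1 / n

/-- The antiderivative `Fⁿ` of `-fⁿ` in the power case, with `fⁿ(x) = (x⁺ + 1/n) ^ (-α)`. -/
noncomputable def FnPow (α : ℝ) (n : ℕ) (x : ℝ) : ℝ :=
  if α = 1 then -Real.log (x⁺ + 1 / n) + n * x⁻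
  else (x⁺ + 1 / n) ^ (1 - α) / (α - 1) + (n : ℝ) ^ α * x⁻

/-- The antiderivative `F(x) = x log x - x + 1` of `log` on `[0,∞)`, with `0 log 0 = 0`;
`+∞` outside `[0,∞)`. -/
noncomputable def FLog (x : ℝ) : EReal :=
  if 0 ≤ x then ((x * Real.log x - x + 1 : ℝ) : EReal) else ⊤

/-- The antiderivative `F` of `-x ^ (-α)` on `(0,∞)`: `F(x) = -log x` if `α = 1` and
`F(x) = x ^ (1 - α) / (α - 1)` otherwise. At `0` it has its limit value (`0` if `α < 1`, and `+∞`
if `α ≥ 1`), and it is `+∞` on `(-∞,0)`. -/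
noncomputable def FPow (α : ℝ) (x : ℝ) : EReal :=
  if 0 < x then
    (((if α = 1 then -Real.log x else x ^ (1 - α) / (α - 1)) : ℝ) : EReal)
  else if x = 0 ∧ α < 1 then 0 else ⊤

/-- The cone `K` of nonnegative functions in `L²(0,1)`. -/
def K : Set L2 := {x | ∀ᵐ θ ∂leb, 0 ≤ x θ}

/-- The regularized potential `Uⁿ(x) = ∫₀¹ Fⁿ(x(θ)) dθ`, for an `Fⁿ` with finite values. -/
noncomputable def Un (Fn : ℝ → ℝ) (x : L2) : ℝ := ∫ θ, Fn (x θ) ∂leb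

open Classical in
/-- The potential `U(x) = ∫₀¹ F(x(θ)) dθ` if `x ∈ K` and `∫₀¹ |F(x(θ))| dθ < ∞`, and `+∞` otherwise.
For `F = FLog` and `x ∈ K` the integral of `|F(x)|` is always finite. -/
noncomputable def U (F : ℝ → EReal) (x : L2) : EReal :=
  if x ∈ K ∧ ∫⁻ θ, (F (x θ)).abs ∂leb < ∞ then ((∫ θ, (F (x θ)).toReal ∂leb : ℝ) : EReal) else ⊤

/-- The measure `Z⁻¹ ρ μ`, where `Z = ∫ ρ dμ`. -/
noncomputable def normalized (μ : Measure L2) (ρ : L2 → ℝ≥0∞) : Measure L2 :=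
  (∫⁻ x, ρ x ∂μ)⁻¹ • μ.withDensity ρ

/-- `ν_cⁿ = (1 / Z_cⁿ) exp (-Uⁿ) μ_c`. -/
noncomputable def nuN (Fn : ℝ → ℝ) (c : ℝ) : Measure L2 :=
  normalized (mu c) fun x => ENNReal.ofReal (Real.exp (-Un Fn x))

/-- `ν_c = (1 / Z_c) exp (-U) 1_K μ_c`. -/
noncomputable def nu (F : ℝ → EReal) (c : ℝ) : Measure L2 :=
  normalized (mu c) (K.indicator fun x => EReal.exp (-U F x))


lemma integral_cos_int (k : ℤ) :
    ∫ θ, Real.cos (k * Real.pi * θ) ∂leb = if k = 0 then 1 else 0 := by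
  split_ifs with h
  · subst h; simp
  · have hk : (k : ℝ) * Real.pi ≠ 0 := mul_ne_zero (by exact_mod_cast h) Real.pi_ne_zero
    rw [← integral_Ioc_eq_integral_Ioo, ← intervalIntegral.integral_of_le zero_le_one,
      intervalIntegral.integral_comp_mul_left (fun x => Real.cos x) hk]
    simp [Real.sin_int_mul_pi]

lemma integral_eFun_mul (i j : ℕ) :
    ∫ θ, eFun i θ * eFun j θ ∂leb = if i = j then 1 else 0 := by
  have hint : ∀ k : ℤ, Integrable (fun θ => Real.cos (k * Real.pi * θ)) leb := fun k =>
    Integrable.of_bound (by fun_prop) 1 (ae_of_all _ fun θ => Real.abs_cos_le_one _)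
  have h2 : √2 * √2 = 2 := Real.mul_self_sqrt (by norm_num)
  have hone : ∀ m : ℕ, m ≠ 0 → ∫ θ, √2 * Real.cos (m * Real.pi * θ) ∂leb = 0 := fun m hm => by
    have := integral_cos_int m
    rw [integral_const_mul]
    simp_all
  by_cases hi : i = 0
  · by_cases hj : j = 0
    · simp [eFun, hi, hj]
    · simp only [eFun, hi, hj, if_true, if_false, one_mul]
      rw [hone j hj, if_neg (Ne.symm hj)]
  · by_cases hj : j = 0
    · simp only [eFun, hi, hj, if_true, if_false, mul_one]
      rw [hone i hi]
    · have key : ∀ θ : ℝ, eFun i θ * eFun j θ =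
          Real.cos (((i - j : ℤ) : ℝ) * Real.pi * θ) +
            Real.cos (((i + j : ℤ) : ℝ) * Real.pi * θ) := fun θ => by
        simp only [eFun, hi, hj, if_false]
        push_cast
        have e1 : ((i : ℝ) - j) * Real.pi * θ = i * Real.pi * θ - j * Real.pi * θ := by ring
        have e2 : ((i : ℝ) + j) * Real.pi * θ = i * Real.pi * θ + j * Real.pi * θ := by ring
        rw [e1, e2, Real.cos_add, Real.cos_sub]
        linear_combination (Real.cos (i * Real.pi * θ) * Real.cos (j * Real.pi * θ)) * h2
      simp_rw [key]
      rw [integral_add (hint _) (hint _), integral_cos_int, integral_cos_int]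
      have h3 : ((i : ℤ) + j) ≠ 0 := by omega
      rw [if_neg h3, add_zero]
      congr 1
      simp [sub_eq_zero]

lemma orthonormal_e : Orthonormal ℝ e := by
  rw [orthonormal_iff_ite]
  intro i j
  rw [← integral_eFun_mul i j, L2.inner_def]
  apply integral_congr_ae
  filter_upwards [(memLp_eFun i).coeFn_toLp, (memLp_eFun j).coeFn_toLp] with θ h1 h2
  simp only [e, h1, h2]
  simp [mul_comm]

instance instIsProbabilityMeasureStdNormalSeq : IsProbabilityMeasure stdNormalSeq := by
  unfold stdNormalSeq; infer_instance

/-- The series defining `gaussianSeries` converges almost surely. -/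
lemma ae_summable_gaussianSeries :
    ∀ᵐ ξ ∂stdNormalSeq,
      Summable fun i : ℕ => (ξ i / ((i + 1 : ℝ) * Real.pi)) • e (i + 1) := by
  have hsq : ∀ᵐ ξ ∂stdNormalSeq,
      Summable fun i : ℕ => (ξ i / ((i + 1 : ℝ) * Real.pi)) ^ 2 := by
    set C : ℝ≥0∞ := ∫⁻ x, ENNReal.ofReal (x ^ 2) ∂gaussianReal 0 1 with hC
    have hCt : C ≠ ∞ := by
      have : MemLp id 2 (gaussianReal 0 1) := memLp_id_gaussianReal 2
      exact this.integrable_sq.lintegral_lt_top.ne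
    have hmeas : ∀ i : ℕ, Measurable fun ξ : ℕ → ℝ =>
        ENNReal.ofReal ((ξ i / ((i + 1 : ℝ) * Real.pi)) ^ 2) := fun i => by fun_prop
    have hfin : ∫⁻ ξ, ∑' i : ℕ, ENNReal.ofReal ((ξ i / ((i + 1 : ℝ) * Real.pi)) ^ 2)
        ∂stdNormalSeq ≠ ∞ := by
      rw [lintegral_tsum (fun i => (hmeas i).aemeasurable)]
      have h1 : ∀ i : ℕ, ∫⁻ ξ, ENNReal.ofReal ((ξ i / ((i + 1 : ℝ) * Real.pi)) ^ 2)
          ∂stdNormalSeq = ENNReal.ofReal ((1 / ((i + 1 : ℝ) * Real.pi)) ^ 2) * C := by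
        intro i
        have hm := measurePreserving_eval_infinitePi (fun _ : ℕ => gaussianReal 0 1) i
        rw [hC, ← hm.lintegral_comp (f := fun x => ENNReal.ofReal (x ^ 2)) (by fun_prop),
          ← lintegral_const_mul _ (by fun_prop)]
        refine lintegral_congr fun ξ => ?_
        rw [← ENNReal.ofReal_mul (by positivity)]
        congr 1
        simp only [Function.eval]
        ring
      simp_rw [h1]
      rw [ENNReal.tsum_mul_right]
      refine ENNReal.mul_ne_top ?_ hCt
      rw [← ENNReal.ofReal_tsum_of_nonneg (fun i => by positivity)]
      · exact ENNReal.ofReal_ne_top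
      · have := ((summable_nat_add_iff 1).2
          (Real.summable_one_div_nat_pow.2 (one_lt_two : 1 < 2))).mul_right ((1 / Real.pi) ^ 2)
        refine this.congr fun i => ?_
        push_cast
        field_simp
    filter_upwards [ae_lt_top' (AEMeasurable.tsum fun i => (hmeas i).aemeasurable) hfin] with ξ hξ
    have := ENNReal.summable_toReal hξ.ne
    refine this.congr fun i => ?_
    rw [ENNReal.toReal_ofReal (sq_nonneg _)]
  filter_upwards [hsq] with ξ hξ
  have ho : Orthonormal ℝ fun i : ℕ => e (i + 1) :=
    orthonormal_e.comp _ (add_left_injective 1)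
  have := (ho.orthogonalFamily.summable_iff_norm_sq_summable
    (fun i : ℕ => ξ i / ((i + 1 : ℝ) * Real.pi))).2 (hξ.congr fun i => by rw [Real.norm_eq_abs, sq_abs])
  simpa using this

/-- Partial sums of `gaussianSeries`. -/
noncomputable def gaussianPartial (c : ℝ) (N : ℕ) (ξ : ℕ → ℝ) : L2 :=
  c • e 0 + ∑ i ∈ Finset.range N, (ξ i / ((i + 1 : ℝ) * Real.pi)) • e (i + 1)

lemma continuous_gaussianPartial (c : ℝ) (N : ℕ) : Continuous (gaussianPartial c N) := by
  unfold gaussianPartial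
  fun_prop

lemma measurable_gaussianPartial (c : ℝ) (N : ℕ) : Measurable (gaussianPartial c N) := by
  have : Fact ((2 : ℝ≥0∞) ≠ ∞) := ⟨by simp⟩
  exact (continuous_gaussianPartial c N).measurable

lemma ae_tendsto_gaussianPartial (c : ℝ) :
    ∀ᵐ ξ ∂stdNormalSeq,
      Tendsto (fun N => gaussianPartial c N ξ) atTop (𝓝 (gaussianSeries c ξ)) := by
  filter_upwards [ae_summable_gaussianSeries] with ξ hξ
  exact hξ.hasSum.tendsto_sum_nat.const_add _

lemma aemeasurable_gaussianSeries (c : ℝ) : AEMeasurable (gaussianSeries c) stdNormalSeq :=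
  aemeasurable_of_tendsto_metrizable_ae atTop
    (fun N => (measurable_gaussianPartial c N).aemeasurable) (ae_tendsto_gaussianPartial c)

instance instIsProbabilityMeasureMu (c : ℝ) : IsProbabilityMeasure (mu c) :=
  Measure.isProbabilityMeasure_map (aemeasurable_gaussianSeries c)

/-- `mu c` is the Gaussian measure with mean `c e₀` and covariance form
`⟨Qh, h⟩ = ∑_{i ≥ 1} ⟨eᵢ, h⟩² / (iπ)²`. -/
theorem charFun_mu (c : ℝ) (h : L2) :
    charFun (mu c) h =
      Complex.exp (((c * inner ℝ (e 0) h : ℝ) : ℂ) * Complex.I -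
        ((∑' i : ℕ, (inner ℝ (e (i + 1)) h) ^ 2 / (((i : ℝ) + 1) * Real.pi) ^ 2 : ℝ) : ℂ) / 2) := by
  set b : ℕ → ℝ := fun i => inner ℝ (e (i + 1)) h / ((i + 1 : ℝ) * Real.pi) with hb
  have hb2 : ∀ i : ℕ, (inner ℝ (e (i + 1)) h) ^ 2 / (((i : ℝ) + 1) * Real.pi) ^ 2 = b i ^ 2 :=
    fun i => by simp only [hb]; rw [div_pow]
  have hsum : Summable fun i => b i ^ 2 := by
    have h1 : Summable fun i : ℕ => ‖inner ℝ (e (i + 1)) h‖ ^ 2 :=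
      (orthonormal_e.comp _ (add_left_injective 1)).inner_products_summable h
    refine Summable.of_nonneg_of_le (fun i => sq_nonneg _) (fun i => ?_) h1
    rw [← hb2, Real.norm_eq_abs, sq_abs]
    refine div_le_self (sq_nonneg _) ?_
    have hpi := Real.pi_gt_three
    have hi : (0 : ℝ) ≤ i := Nat.cast_nonneg i
    have : 1 ≤ ((i : ℝ) + 1) * Real.pi := by nlinarith
    exact one_le_pow₀ this
  simp_rw [hb2]
  rw [charFun_apply, mu, integral_map (aemeasurable_gaussianSeries c) (by fun_prop)]
  -- the characteristic functions of the partial sums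
  have hpart : ∀ N : ℕ, ∫ ξ, Complex.exp (((inner ℝ (gaussianPartial c N ξ) h : ℝ) : ℂ) * Complex.I)
      ∂stdNormalSeq = Complex.exp (((c * inner ℝ (e 0) h : ℝ) : ℂ) * Complex.I -
        ((∑ i ∈ Finset.range N, b i ^ 2 : ℝ) : ℂ) / 2) := by
    intro N
    have h1 : ∀ ξ : ℕ → ℝ,
        Complex.exp (((inner ℝ (gaussianPartial c N ξ) h : ℝ) : ℂ) * Complex.I) =
        Complex.exp (((c * inner ℝ (e 0) h : ℝ) : ℂ) * Complex.I) *
          ∏ i : Fin N, Complex.exp ((b i : ℂ) * (ξ i : ℂ) * Complex.I) := by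
      intro ξ
      rw [← Complex.exp_sum, ← Complex.exp_add]
      congr 1
      rw [← Finset.sum_mul, ← add_mul]
      congr 1
      rw [Fin.sum_univ_eq_sum_range (fun i => (b i : ℂ) * (ξ i : ℂ)) N]
      rw [gaussianPartial, inner_add_left, sum_inner, real_inner_smul_left]
      push_cast
      congr 1
      refine Finset.sum_congr rfl fun i _ => ?_
      rw [real_inner_smul_left]
      simp only [hb]
      push_cast
      ring
    simp_rw [h1]
    rw [integral_const_mul]
    have hind : iIndepFun (fun (i : Fin N) (ξ : ℕ → ℝ) => ξ i) stdNormalSeq :=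
      (iIndepFun_infinitePi (P := fun _ : ℕ => gaussianReal 0 1)
        (X := fun _ x => x) (by fun_prop)).precomp Fin.val_injective
    rw [iIndepFun.integral_fun_prod_comp (X := fun (i : Fin N) (ξ : ℕ → ℝ) => ξ i) hind
      (f := fun i x => Complex.exp ((b i : ℂ) * (x : ℂ) * Complex.I))
      (fun i => (measurable_pi_apply _).aemeasurable) (fun i => by fun_prop)]
    have h2 : ∀ i : Fin N, ∫ ξ, Complex.exp ((b i : ℂ) * (ξ i : ℂ) * Complex.I) ∂stdNormalSeq =
        Complex.exp (-((b i ^ 2 : ℝ) : ℂ) / 2) := by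
      intro i
      have hm := measurePreserving_eval_infinitePi (fun _ : ℕ => gaussianReal 0 1) (i : ℕ)
      have h3 := charFun_gaussianReal (μ := 0) (v := 1) (b i)
      rw [charFun_apply_real, ← hm.map_eq, integral_map hm.measurable.aemeasurable
        (by fun_prop)] at h3
      refine h3.trans ?_
      congr 1
      push_cast
      simp
      ring
    simp_rw [h2]
    rw [← Complex.exp_sum, ← Complex.exp_add]
    congr 1
    rw [Fin.sum_univ_eq_sum_range (fun i => -((b i ^ 2 : ℝ) : ℂ) / 2) N, ← Finset.sum_div,
      Finset.sum_neg_distrib]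
    push_cast
    ring
  refine tendsto_nhds_unique (f := fun N : ℕ => ∫ ξ, Complex.exp
      (((inner ℝ (gaussianPartial c N ξ) h : ℝ) : ℂ) * Complex.I) ∂stdNormalSeq) (l := atTop) ?_ ?_
  · refine tendsto_integral_of_dominated_convergence (fun _ => (1 : ℝ)) (fun N => ?_)
      (integrable_const _) (fun N => ae_of_all _ fun ξ => ?_) ?_
    · have := continuous_gaussianPartial c N
      exact Continuous.aestronglyMeasurable (by fun_prop)
    · rw [Complex.norm_exp_ofReal_mul_I]
    · filter_upwards [ae_tendsto_gaussianPartial c] with ξ hξ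
      have hcont : Continuous fun x : L2 =>
        Complex.exp (((inner ℝ x h : ℝ) : ℂ) * Complex.I) := by fun_prop
      exact (hcont.tendsto _).comp hξ
  · simp_rw [hpart]
    have hcont : Continuous fun s : ℝ =>
      Complex.exp (((c * inner ℝ (e 0) h : ℝ) : ℂ) * Complex.I - (s : ℂ) / 2) := by fun_prop
    exact (hcont.tendsto _).comp hsum.hasSum.tendsto_sum_nat

end CahnHilliard

open CahnHilliard

namespace CahnHilliard

/-! The densities `exp (-Uⁿ)` converge at every point of `L²(0,1)`, and dominated convergence does
the rest. Off `K` the penalty on `x⁻` sends `Uⁿ` to `+∞`. On `K`, dominated convergence applies if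
`F ∘ x` is integrable; otherwise Fatou gives `Uⁿ → +∞`, so the limit density is `0` there too
(`tendsto_density`).

The domination comes from conservation of mass. Each `Fn` is bounded below by the same affine
function `-A x - D`, hence `Uⁿ x ≥ -A ∫ x - D`; and `∫ x = c` holds `μ_c`-almost surely because `Q
e₀ = 0` (`ae_integral_eq`). So the densities are at most `exp (A c + D)`, uniformly in `n`. Testing
against `1` gives convergence of the normalizing constants.

The hard point is `Z_c > 0`, since `K` has empty interior in `L²`. It suffices that `μ_c` charges
the functions with values in `[c/2, 3c/2]`, on which `F` is bounded. This is a small-ball estimate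
in the uniform norm (`mu_band_pos`): the high dyadic blocks of the random cosine series are all
small with positive probability, by sub-Gaussian tails on fine grids; the finitely many remaining
coefficients are independent of them and small with positive probability.

`IsRegularization` isolates what is used of the potentials, so that both cases share one proof. -/

/-- The properties of a sequence of regularized potentials `Fn` and of its limit `F` on which the
convergence of the Gibbs measures depends. -/
structure IsRegularization (Fn : ℕ → ℝ → ℝ) (F : ℝ → EReal) (A C D : ℝ) (r : ℕ → ℝ) : Prop where
  continuous : ∀ n, Continuous (Fn n)
  growth : ∀ n, ∃ B, ∀ x, |Fn n x| ≤ B * (1 + x ^ 2)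
  nonneg : 0 ≤ A
  const_nonneg : 0 ≤ C
  lower : ∀ n x, r n * x⁻ - A * x⁺ - D ≤ Fn n x
  -- Lets the penalty on `x⁻` absorb `A x⁻`, which turns `lower` into a bound affine in `x`.
  le_rate : ∀ n, A ≤ r n
  tendsto_rate : Tendsto r atTop atTop
  tendsto_coe : ∀ x, 0 ≤ x → Tendsto (fun n => (Fn n x : EReal)) atTop (𝓝 (F x))
  dominated : ∀ n x, 0 ≤ x →
    ENNReal.ofReal |Fn n x| ≤ (F x).abs + ENNReal.ofReal (C * (1 + x ^ 2))
  finite_of_pos : ∃ g : ℝ → ℝ, ContinuousOn g (Set.Ioi 0) ∧ ∀ x, 0 < x → F x = (g x : EReal)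

/-! ### Integrability, measurability of `Uⁿ`, and conservation of the mean. -/

lemma integrable_coe (x : L2) : Integrable (fun θ => x θ) leb :=
  (Lp.memLp x).integrable (by norm_num)

lemma integrable_quadratic (B : ℝ) (x : L2) : Integrable (fun θ => B * (1 + x θ ^ 2)) leb :=
  ((integrable_const 1).add (Lp.memLp x).integrable_sq).const_mul B

lemma integrable_comp_of_growth {f : ℝ → ℝ} (hf : Continuous f) {B : ℝ}
    (hB : ∀ x, |f x| ≤ B * (1 + x ^ 2)) (x : L2) : Integrable (fun θ => f (x θ)) leb :=
  (integrable_quadratic B x).mono' (hf.comp_aestronglyMeasurable (Lp.aestronglyMeasurable x))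
    (ae_of_all _ fun _ => hB _)

/-- A sequence converging in `L²` has a subsequence converging almost everywhere, to which bounded
convergence applies; sequential continuity only needs subsequences. -/
lemma continuous_Un_of_bounded {f : ℝ → ℝ} (hf : Continuous f) {B : ℝ} (hB : ∀ x, |f x| ≤ B) :
    Continuous (Un f) := by
  refine continuous_iff_seqContinuous.2 fun u x hu => ?_
  refine tendsto_of_subseq_tendsto fun ns hns => ?_
  obtain ⟨φ, -, hφ⟩ :=
    (tendstoInMeasure_of_tendsto_Lp (hu.comp hns)).exists_seq_tendsto_ae
  refine ⟨φ, ?_⟩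
  refine tendsto_integral_of_dominated_convergence (fun _ => B)
    (fun n => hf.comp_aestronglyMeasurable (Lp.aestronglyMeasurable _)) (integrable_const _)
    (fun n => ae_of_all _ fun _ => hB _) ?_
  filter_upwards [hφ] with θ hθ
  exact (hf.tendsto _).comp hθ

lemma measurable_Un {f : ℝ → ℝ} (hf : Continuous f) {B : ℝ}
    (hB : ∀ x, |f x| ≤ B * (1 + x ^ 2)) : Measurable (Un f) := by
  -- Clipping to `[-m, m]` makes `f ∘ t m` bounded, so `Un f` is a pointwise limit of continuous
  -- functions.
  set t : ℕ → ℝ → ℝ := fun m x => max (-(m : ℝ)) (min m x) with ht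
  have htc : ∀ m, Continuous (t m) := fun m => by simp only [ht]; fun_prop
  have hm0 : ∀ m : ℕ, (0 : ℝ) ≤ m := fun m => Nat.cast_nonneg m
  have htm : ∀ m x, |t m x| ≤ m := fun m x =>
    abs_le.2 ⟨le_max_left _ _, max_le (by linarith [hm0 m]) (min_le_left _ _)⟩
  have htx : ∀ m x, |t m x| ≤ |x| := fun m x => by
    refine abs_le.2 ⟨le_max_of_le_right (le_min ?_ (neg_abs_le x)), max_le ?_ ?_⟩
    · linarith [hm0 m, abs_nonneg x]
    · linarith [hm0 m, abs_nonneg x]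
    · exact (min_le_right _ _).trans (le_abs_self x)
  have hB0 : 0 ≤ B := by
    have h0 := (abs_nonneg _).trans (hB 0)
    simpa using h0
  have hlim : ∀ x, ∀ᶠ m : ℕ in atTop, t m x = x := fun x => by
    filter_upwards [eventually_ge_atTop ⌈|x|⌉₊] with m hm
    have h := abs_le.1 (Nat.ceil_le.1 hm)
    simp only [ht]
    rw [min_eq_right h.2, max_eq_right h.1]
  refine measurable_of_tendsto_metrizable (f := fun m => Un (f ∘ t m)) (fun m => ?_) ?_
  · refine (continuous_Un_of_bounded (hf.comp (htc m)) (B := B * (1 + m ^ 2)) fun x => ?_).measurable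
    refine (hB _).trans ?_
    have := sq_le_sq.2 ((htm m x).trans (le_abs_self _))
    gcongr
  · refine tendsto_pi_nhds.2 fun x => ?_
    refine tendsto_integral_of_dominated_convergence (fun θ => B * (1 + x θ ^ 2))
      (fun m => (hf.comp (htc m)).comp_aestronglyMeasurable (Lp.aestronglyMeasurable _))
      (integrable_quadratic B x) (fun m => ae_of_all _ fun θ => ?_) (ae_of_all _ fun θ => ?_)
    · refine (hB _).trans ?_
      have := sq_le_sq.2 (htx m (x θ))
      gcongr
    · refine tendsto_const_nhds.congr' ?_
      filter_upwards [hlim (x θ)] with m hm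
      simp [hm]

/-- `μ_c`-almost every function has mean `c`. -/
lemma ae_integral_eq (c : ℝ) : ∀ᵐ x ∂mu c, ∫ θ, x θ ∂leb = c := by
  have hin : ∀ x : L2, ∫ θ, x θ ∂leb = inner ℝ (e 0) x := fun x => by
    rw [L2.inner_def]
    refine integral_congr_ae ?_
    filter_upwards [(memLp_eFun 0).coeFn_toLp] with θ h1
    simp only [e, h1]
    simp [eFun]
  simp_rw [hin]
  have hcl : IsClosed {x : L2 | inner ℝ (e 0) x = c} :=
    isClosed_eq (by fun_prop) continuous_const
  rw [mu, ae_map_iff (aemeasurable_gaussianSeries c) hcl.measurableSet]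
  filter_upwards [ae_tendsto_gaussianPartial c] with ξ hξ
  -- Every partial sum lies on the closed hyperplane of functions of mean `c`, since `e 0` is
  -- orthogonal to the other modes.
  refine hcl.mem_of_tendsto hξ (Eventually.of_forall fun N => ?_)
  have ho := orthonormal_iff_ite.1 orthonormal_e
  simp only [Set.mem_ofPred_eq, gaussianPartial, inner_add_right, inner_sum, real_inner_smul_right, ho]
  simp

/-! ### Pointwise convergence of the densities. -/

variable {Fn : ℕ → ℝ → ℝ} {F : ℝ → EReal} {A C D : ℝ} {r : ℕ → ℝ}

namespace IsRegularization

lemma integrable (h : IsRegularization Fn F A C D r) (n : ℕ) (x : L2) :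
    Integrable (fun θ => Fn n (x θ)) leb := by
  obtain ⟨B, hB⟩ := h.growth n
  exact integrable_comp_of_growth (h.continuous n) hB x

/-- As `x⁺ = x + x⁻`, the bound `lower` exceeds `-(A x + D)` by `(r n - A) x⁻`. An affine bound
integrates to a function of the mean alone. -/
lemma linear_le (h : IsRegularization Fn F A C D r) (n : ℕ) (x : ℝ) :
    0 ≤ Fn n x + (A * x + D) := by
  have h1 := h.lower n x
  have h2 := mul_le_mul_of_nonneg_right (h.le_rate n) (negPart_nonneg x)
  have h3 : A * x = A * x⁺ - A * x⁻ := by rw [← mul_sub, posPart_sub_negPart]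
  linarith

lemma integrable_add (h : IsRegularization Fn F A C D r) (n : ℕ) (x : L2) :
    Integrable (fun θ => Fn n (x θ) + (A * x θ + D)) leb :=
  (h.integrable n x).add (((integrable_coe x).const_mul A).add (integrable_const D))

lemma integral_add (h : IsRegularization Fn F A C D r) (n : ℕ) (x : L2) :
    ∫ θ, (Fn n (x θ) + (A * x θ + D)) ∂leb = Un (Fn n) x + (A * ∫ θ, x θ ∂leb) + D := by
  have hlin : Integrable (fun θ => A * x θ + D) leb :=
    ((integrable_coe x).const_mul A).add (integrable_const D)
  rw [MeasureTheory.integral_add (h.integrable n x) hlin,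
    MeasureTheory.integral_add ((integrable_coe x).const_mul A) (integrable_const D),
    integral_const_mul]
  simp [Un, add_assoc]

lemma le_Un (h : IsRegularization Fn F A C D r) (n : ℕ) (x : L2) :
    -(A * ∫ θ, x θ ∂leb) - D ≤ Un (Fn n) x := by
  have h1 : 0 ≤ ∫ θ, (Fn n (x θ) + (A * x θ + D)) ∂leb :=
    integral_nonneg fun θ => h.linear_le n (x θ)
  rw [h.integral_add] at h1
  linarith

/-- Integrating `lower` gives growth at rate `r n ∫ x⁻`, with `∫ x⁻ > 0` outside `K`. -/
lemma tendsto_Un_of_notMem (h : IsRegularization Fn F A C D r) {x : L2} (hx : x ∉ K) :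
    Tendsto (fun n => Un (Fn n) x) atTop atTop := by
  have hneg : Integrable (fun θ => (x θ)⁻) leb := (integrable_coe x).neg_part
  have hpos : Integrable (fun θ => (x θ)⁺) leb := (integrable_coe x).pos_part
  have h0 : 0 < ∫ θ, (x θ)⁻ ∂leb := by
    refine (integral_nonneg fun θ => negPart_nonneg _).lt_of_ne fun h0 => hx ?_
    have := (integral_eq_zero_iff_of_nonneg (fun θ => negPart_nonneg _) hneg).1 h0.symm
    filter_upwards [this] with θ hθ
    exact negPart_eq_zero.1 hθ
  have hle : ∀ n, (∫ θ, (x θ)⁻ ∂leb) * r n + (-(A * ∫ θ, (x θ)⁺ ∂leb) - D) ≤ Un (Fn n) x := by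
    intro n
    have hsub : Integrable (fun θ => r n * (x θ)⁻ - A * (x θ)⁺) leb :=
      (hneg.const_mul (r n)).sub (hpos.const_mul A)
    have h1 := integral_mono
      (hsub.sub (integrable_const D)) (h.integrable n x)
      (fun θ => h.lower n (x θ))
    have h2 : ∫ θ, (r n * (x θ)⁻ - A * (x θ)⁺ - D) ∂leb
        = r n * ∫ θ, (x θ)⁻ ∂leb - (A * ∫ θ, (x θ)⁺ ∂leb) - D := by
      rw [integral_sub hsub (integrable_const D),
        integral_sub (hneg.const_mul (r n)) (hpos.const_mul A), integral_const_mul,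
        integral_const_mul]
      simp
    change ∫ θ, (r n * (x θ)⁻ - A * (x θ)⁺ - D) ∂leb ≤ _ at h1
    rw [h2] at h1
    unfold Un
    linarith
  exact tendsto_atTop_mono hle
    (tendsto_atTop_add_const_right _ _ (h.tendsto_rate.const_mul_atTop h0))

lemma ne_bot (h : IsRegularization Fn F A C D r) {x : ℝ} (hx : 0 ≤ x) : F x ≠ ⊥ := by
  have h1 : ((-(A * x + D) : ℝ) : EReal) ≤ F x :=
    ge_of_tendsto' (h.tendsto_coe x hx) fun n =>
      EReal.coe_le_coe_iff.2 (by linarith [h.linear_le n x])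
  intro h2
  rw [h2, le_bot_iff] at h1
  exact EReal.coe_ne_bot _ h1

lemma tendsto_Un_of_integrable (h : IsRegularization Fn F A C D r) {x : L2} (hx : x ∈ K)
    (hF : ∫⁻ θ, (F (x θ)).abs ∂leb < ∞) :
    Tendsto (fun n => Un (Fn n) x) atTop (𝓝 (∫ θ, (F (x θ)).toReal ∂leb)) := by
  -- Measurability of `F` is not assumed: on `K` it is inherited from the approximations `Fn`.
  have hmeas : AEMeasurable (fun θ => F (x θ)) leb := by
    refine aemeasurable_of_tendsto_metrizable_ae atTop
      (f := fun (n : ℕ) θ => ((Fn n (x θ) : ℝ) : EReal)) (fun n => ?_) ?_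
    · exact ((h.continuous n).measurable.comp_aemeasurable
        (Lp.aestronglyMeasurable x).aemeasurable).coe_real_ereal
    · filter_upwards [hx] with θ hθ using h.tendsto_coe _ hθ
  have habs : AEMeasurable (fun θ => (F (x θ)).abs) leb := by
    refine Measurable.comp_aemeasurable (g := EReal.abs) ?_ hmeas
    refine EReal.measurable_of_measurable_real ?_
    simp only [EReal.abs_def]
    fun_prop
  have hlt := ae_lt_top' habs hF.ne
  refine tendsto_integral_of_dominated_convergence
    (fun θ => (F (x θ)).abs.toReal + C * (1 + x θ ^ 2)) (fun n => (h.integrable n x).1) ?_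
    (fun n => ?_) ?_
  · exact (integrable_toReal_of_lintegral_ne_top habs hF.ne).add (integrable_quadratic C x)
  · filter_upwards [hx, hlt] with θ hθ hfin
    have h1 := h.dominated n _ hθ
    have hC : 0 ≤ C * (1 + x θ ^ 2) := mul_nonneg h.const_nonneg (by positivity)
    rw [← ENNReal.ofReal_toReal hfin.ne, ← ENNReal.ofReal_add ENNReal.toReal_nonneg hC,
      ENNReal.ofReal_le_ofReal_iff (add_nonneg ENNReal.toReal_nonneg hC)] at h1
    exact h1
  · filter_upwards [hx, hlt] with θ hθ hfin
    have hbot := h.ne_bot hθ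
    have htop : F (x θ) ≠ ⊤ := fun h1 => by simp [h1] at hfin
    have h1 := h.tendsto_coe _ hθ
    exact (EReal.tendsto_toReal htop hbot).comp h1

/-- Fatou applied to the nonnegative functions `Fn + A x + D`. Their limit `G` has infinite integral
because `|F| ≤ G + |A x + D|` and the affine term is integrable. -/
lemma tendsto_Un_of_not_integrable (h : IsRegularization Fn F A C D r) {x : L2} (hx : x ∈ K)
    (hF : ∫⁻ θ, (F (x θ)).abs ∂leb = ∞) :
    Tendsto (fun n => Un (Fn n) x) atTop atTop := by
  set G : ℝ → ℝ≥0∞ := fun y => (F y + ((A * y + D : ℝ) : EReal)).toENNReal with hG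
  have hlin : ∫⁻ θ, ENNReal.ofReal |A * x θ + D| ∂leb ≠ ∞ := by
    have : Integrable (fun θ => A * x θ + D) leb :=
      ((integrable_coe x).const_mul A).add (integrable_const D)
    simpa [ofReal_norm] using (hasFiniteIntegral_iff_norm _).1 this.2 |>.ne
  have hGtop : ∫⁻ θ, G (x θ) ∂leb = ∞ := by
    have hle : ∫⁻ θ, (F (x θ)).abs ∂leb
        ≤ ∫⁻ θ, (G (x θ) + ENNReal.ofReal |A * x θ + D|) ∂leb := by
      refine lintegral_mono_ae ?_
      filter_upwards [hx] with θ hθ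
      have hb := h.ne_bot hθ
      have hl := h.tendsto_coe _ hθ
      have h1 : ((-(A * x θ + D) : ℝ) : EReal) ≤ F (x θ) :=
        ge_of_tendsto' hl fun n => EReal.coe_le_coe_iff.2 (by linarith [h.linear_le n (x θ)])
      simp only [hG]
      induction hFx : F (x θ) using EReal.rec with
      | bot => exact absurd hFx hb
      | top => rw [EReal.top_add_coe]; simp
      | coe a =>
        rw [hFx, EReal.coe_le_coe_iff] at h1
        rw [← EReal.coe_add, EReal.real_coe_toENNReal, ← ENNReal.ofReal_add (by linarith)
          (abs_nonneg _), EReal.abs_def]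
        refine ENNReal.ofReal_le_ofReal (abs_le.2 ⟨?_, ?_⟩)
        · linarith [le_abs_self (A * x θ + D)]
        · linarith [neg_abs_le (A * x θ + D)]
    rw [hF, lintegral_add_right' _ (by
      have := Lp.aestronglyMeasurable x |>.aemeasurable
      fun_prop)] at hle
    by_contra hne
    exact (ENNReal.add_lt_top.2 ⟨lt_top_iff_ne_top.2 hne, lt_top_iff_ne_top.2 hlin⟩).not_ge hle
  have hlim : ∫⁻ θ, liminf (fun n => ENNReal.ofReal (Fn n (x θ) + (A * x θ + D))) atTop ∂leb = ∞ := by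
    rw [← hGtop]
    refine lintegral_congr_ae ?_
    filter_upwards [hx] with θ hθ
    refine Tendsto.liminf_eq ?_
    have h1 := h.tendsto_coe _ hθ
    have h2 : Tendsto (fun n => (((Fn n (x θ) : ℝ) : EReal) + ((A * x θ + D : ℝ) : EReal)))
        atTop (𝓝 (F (x θ) + ((A * x θ + D : ℝ) : EReal))) :=
      ((EReal.continuousAt_add (p := (F (x θ), ((A * x θ + D : ℝ) : EReal)))
        (Or.inr (EReal.coe_ne_bot _)) (Or.inr (EReal.coe_ne_top _))).tendsto).comp (h1.prodMk_nhds tendsto_const_nhds)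
    exact (EReal.continuous_toENNReal.tendsto _).comp h2
  have hfatou := lintegral_liminf_le' (μ := leb) (u := atTop)
    (f := fun n θ => ENNReal.ofReal (Fn n (x θ) + (A * x θ + D)))
    (fun n => (h.integrable_add n x).1.aemeasurable.ennreal_ofReal)
  rw [hlim, top_le_iff] at hfatou
  have h3 : ∀ n, ∫⁻ θ, ENNReal.ofReal (Fn n (x θ) + (A * x θ + D)) ∂leb
      = ENNReal.ofReal (Un (Fn n) x + (A * ∫ θ, x θ ∂leb) + D) := fun n => by
    rw [← h.integral_add n x, ofReal_integral_eq_lintegral_ofReal (h.integrable_add n x)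
      (ae_of_all _ fun θ => h.linear_le n (x θ))]
  simp_rw [h3] at hfatou
  refine tendsto_atTop.2 fun b => ?_
  have h4 := eventually_lt_of_lt_liminf (hfatou ▸ ENNReal.ofReal_lt_top (r := |b + (A * ∫ θ, x θ ∂leb) + D|))
  filter_upwards [h4] with n hn
  have h5 := lt_of_not_ge fun h => hn.not_ge (ENNReal.ofReal_le_ofReal h)
  linarith [le_abs_self (b + (A * ∫ θ, x θ ∂leb) + D)]

/-- The densities converge at every point of `L²(0,1)`. -/
lemma tendsto_density (h : IsRegularization Fn F A C D r) (x : L2) :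
    Tendsto (fun n => ENNReal.ofReal (Real.exp (-Un (Fn n) x))) atTop
      (𝓝 (K.indicator (fun x => EReal.exp (-U F x)) x)) := by
  have key : Tendsto (fun n => Un (Fn n) x) atTop atTop →
      Tendsto (fun n => ENNReal.ofReal (Real.exp (-Un (Fn n) x))) atTop (𝓝 0) := fun h1 => by
    rw [← ENNReal.ofReal_zero]
    exact (ENNReal.continuous_ofReal.tendsto _).comp
      (Real.tendsto_exp_neg_atTop_nhds_zero.comp h1)
  by_cases hx : x ∈ K
  · rw [Set.indicator_of_mem hx]
    by_cases hF : ∫⁻ θ, (F (x θ)).abs ∂leb < ∞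
    · rw [U, if_pos ⟨hx, hF⟩, ← EReal.coe_neg, EReal.exp_coe]
      exact ((ENNReal.continuous_ofReal.comp (Real.continuous_exp.comp continuous_neg)).tendsto
        _).comp (h.tendsto_Un_of_integrable hx hF)
    · rw [U, if_neg fun h1 => hF h1.2, EReal.neg_top, EReal.exp_bot]
      exact key (h.tendsto_Un_of_not_integrable hx (not_lt_top_iff.1 hF))
  · rw [Set.indicator_of_notMem hx]
    exact key (h.tendsto_Un_of_notMem hx)

end IsRegularization

/-! ### Uniform small-ball estimate for the Gaussian measure. -/

/-- The functions `eᵢ₊₁ / ((i + 1) π)`, whose random combination is the centred Gaussian series. -/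
noncomputable def mode (i : ℕ) (θ : ℝ) : ℝ := eFun (i + 1) θ / ((i + 1 : ℝ) * Real.pi)

lemma sqrt_two_le_two : √2 ≤ 2 := Real.sqrt_le_iff.2 (by norm_num)

lemma abs_mode_le (i : ℕ) (θ : ℝ) : |mode i θ| ≤ 1 / (i + 1 : ℝ) := by
  have hi : (0 : ℝ) < i + 1 := by positivity
  have hpi := Real.pi_gt_three
  rw [mode, eFun, if_neg i.succ_ne_zero, abs_div, abs_mul, abs_of_nonneg (Real.sqrt_nonneg 2),
    abs_of_pos (mul_pos hi Real.pi_pos), div_le_div_iff₀ (mul_pos hi Real.pi_pos) hi, one_mul,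
    mul_comm]
  gcongr
  have := Real.abs_cos_le_one (((i + 1 : ℕ) : ℝ) * Real.pi * θ)
  nlinarith [sqrt_two_le_two, Real.sqrt_nonneg 2, abs_nonneg (Real.cos (((i + 1 : ℕ) : ℝ) * Real.pi * θ))]

/-- The factor `1 / ((i + 1) π)` cancels the frequency, so the Lipschitz constant does not depend on
`i`. -/
lemma abs_mode_sub_le (i : ℕ) (θ η : ℝ) : |mode i θ - mode i η| ≤ 2 * |θ - η| := by
  have hi : (0 : ℝ) < (i + 1) * Real.pi := by positivity
  have hcos : |Real.cos ((i + 1) * Real.pi * θ) - Real.cos ((i + 1) * Real.pi * η)|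
      ≤ (i + 1) * Real.pi * |θ - η| := by
    refine (Real.abs_cos_sub_cos_le _ _).trans_eq ?_
    rw [← mul_sub, abs_mul, abs_of_pos hi]
  rw [mode, mode, ← sub_div, abs_div, abs_of_pos hi, div_le_iff₀ hi, eFun, eFun,
    if_neg i.succ_ne_zero, if_neg i.succ_ne_zero, ← mul_sub, abs_mul,
    abs_of_nonneg (Real.sqrt_nonneg 2)]
  push_cast
  calc _ ≤ 2 * ((i + 1) * Real.pi * |θ - η|) :=
        mul_le_mul sqrt_two_le_two hcos (abs_nonneg _) (by norm_num)
    _ = _ := by ring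

/-- The indices `i` with `2 ^ k ≤ i + 1 < 2 ^ (k + 1)`. -/
def dyadicBlock (k : ℕ) : Finset ℕ := Finset.Ico (2 ^ k - 1) (2 ^ (k + 1) - 1)

lemma card_dyadicBlock (k : ℕ) : (dyadicBlock k).card = 2 ^ k := by
  rw [dyadicBlock, Nat.card_Ico, pow_succ]
  have := Nat.one_le_two_pow (n := k)
  omega

lemma le_of_mem_dyadicBlock {k i : ℕ} (hi : i ∈ dyadicBlock k) : (2 : ℝ) ^ k ≤ i + 1 := by
  have h1 := (Finset.mem_Ico.1 hi).1
  have : 2 ^ k ≤ i + 1 := by omega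
  exact_mod_cast this

/-- A dyadic block of the random cosine series. -/
noncomputable def blockSum (k : ℕ) (ξ : ℕ → ℝ) (θ : ℝ) : ℝ :=
  ∑ i ∈ dyadicBlock k, mode i θ * ξ i

lemma sum_range_eq_add_sum_blockSum (ξ : ℕ → ℝ) (θ : ℝ) {m L : ℕ} (h : m ≤ L) :
    ∑ i ∈ Finset.range (2 ^ L - 1), mode i θ * ξ i =
      ∑ i ∈ Finset.range (2 ^ m - 1), mode i θ * ξ i +
        ∑ k ∈ Finset.Ico m L, blockSum k ξ θ := by
  induction L, h using Nat.le_induction with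
  | base => simp
  | succ L hL ih =>
    rw [Finset.sum_Ico_succ_top hL, ← add_assoc, ← ih, blockSum, dyadicBlock]
    refine (Finset.sum_range_add_sum_Ico _ ?_).symm
    exact Nat.sub_le_sub_right (Nat.pow_le_pow_right two_pos L.le_succ) 1

/-- The coefficient sequences for which the block `k` is small on a fine grid and has coefficients
of moderate size. -/
def goodBlock (k : ℕ) : Set (ℕ → ℝ) :=
  {ξ | (∀ j ∈ Finset.range (8 ^ k + 1), |blockSum k ξ (j / 8 ^ k)| ≤ (9 / 10) ^ k) ∧
    ∀ i ∈ dyadicBlock k, |ξ i| ≤ 2 ^ k}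

/-- Compare with the nearest grid point to the left. The block has `2 ^ k` terms, each with
coefficient at most `2 ^ k` and variation at most `2 / 8 ^ k`; the mesh `8 ^ (-k)` leaves a summable
error `2 / 2 ^ k`. -/
lemma abs_blockSum_le {k : ℕ} {ξ : ℕ → ℝ} (hξ : ξ ∈ goodBlock k) {θ : ℝ}
    (hθ : θ ∈ Set.Icc (0 : ℝ) 1) :
    |blockSum k ξ θ| ≤ (9 / 10) ^ k + 2 * (1 / 2) ^ k := by
  have h8 : (0 : ℝ) < 8 ^ k := by positivity
  set j : ℕ := ⌊8 ^ k * θ⌋₊ with hj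
  have hj1 : (j : ℝ) ≤ 8 ^ k * θ := Nat.floor_le (mul_nonneg h8.le hθ.1)
  have hj2 : 8 ^ k * θ < j + 1 := Nat.lt_floor_add_one _
  have hjm : j ∈ Finset.range (8 ^ k + 1) := by
    rw [Finset.mem_range, Nat.lt_succ_iff]
    have : (j : ℝ) ≤ 8 ^ k := hj1.trans (mul_le_of_le_one_right h8.le hθ.2)
    exact_mod_cast this
  have hdist : |θ - j / 8 ^ k| ≤ 1 / 8 ^ k := by
    rw [abs_of_nonneg]
    · rw [sub_le_iff_le_add, ← add_div, le_div_iff₀ h8]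
      linarith
    · rw [sub_nonneg, div_le_iff₀ h8]
      linarith
  have hdiff : |blockSum k ξ θ - blockSum k ξ (j / 8 ^ k)| ≤ 2 * (1 / 2) ^ k := by
    rw [blockSum, blockSum, ← Finset.sum_sub_distrib]
    calc _ ≤ ∑ i ∈ dyadicBlock k, |mode i θ * ξ i - mode i (j / 8 ^ k) * ξ i| :=
          Finset.abs_sum_le_sum_abs _ _
      _ ≤ ∑ i ∈ dyadicBlock k, 2 * (1 / 8 ^ k) * 2 ^ k := by
          refine Finset.sum_le_sum fun i hi => ?_
          rw [← sub_mul, abs_mul]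
          refine mul_le_mul ((abs_mode_sub_le _ _ _).trans ?_) (hξ.2 i hi) (abs_nonneg _)
            (by positivity)
          gcongr
      _ = 2 * (1 / 2) ^ k := by
          rw [Finset.sum_const, card_dyadicBlock, nsmul_eq_mul]
          have : (8 : ℝ) ^ k = 2 ^ k * 2 ^ k * 2 ^ k := by rw [← mul_pow, ← mul_pow]; norm_num
          rw [this, one_div_pow]
          push_cast
          field_simp
  have h1 := hξ.1 j hjm
  rw [← sub_add_cancel (blockSum k ξ θ) (blockSum k ξ (j / 8 ^ k))]
  exact (abs_add_le _ _).trans (by linarith)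

/-- The σ-algebra is arbitrary and only the coordinates of the block matter, so that the event can
be placed in the σ-algebra of the high coordinates in `stdNormalSeq_head_inter_tail`. -/
lemma measurableSet_goodBlock {Ω : Type*} {mΩ : MeasurableSpace Ω} {X : ℕ → Ω → ℝ} {k : ℕ}
    (hX : ∀ i ∈ dyadicBlock k, Measurable (X i)) :
    MeasurableSet {ω | (fun i => X i ω) ∈ goodBlock k} := by
  have hS : ∀ θ, Measurable fun ω => |blockSum k (fun i => X i ω) θ| := fun θ =>
    continuous_abs.measurable.comp
      (Finset.measurable_fun_sum _ fun i hi => (hX i hi).const_mul _)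
  have h1 : MeasurableSet (⋂ j ∈ Finset.range (8 ^ k + 1),
      {ω | |blockSum k (fun i => X i ω) (j / 8 ^ k)| ≤ (9 / 10) ^ k}) :=
    Finset.measurableSet_biInter _ fun j _ => measurableSet_le (hS _) measurable_const
  have h2 : MeasurableSet (⋂ i ∈ dyadicBlock k, {ω | |X i ω| ≤ 2 ^ k}) :=
    Finset.measurableSet_biInter _ fun i hi =>
      measurableSet_le (continuous_abs.measurable.comp (hX i hi)) measurable_const
  convert h1.inter h2 using 1
  ext ω
  simp [goodBlock]

lemma hasSubgaussianMGF_mono {Ω : Type*} {mΩ : MeasurableSpace Ω} {μ : Measure Ω} {X : Ω → ℝ}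
    {a b : NNReal} (h : HasSubgaussianMGF X a μ) (hab : a ≤ b) : HasSubgaussianMGF X b μ where
  integrable_exp_mul := h.integrable_exp_mul
  mgf_le t := (h.mgf_le t).trans (Real.exp_le_exp.2 (by gcongr))

lemma hasSubgaussianMGF_eval (i : ℕ) :
    HasSubgaussianMGF (fun ξ : ℕ → ℝ => ξ i) 1 stdNormalSeq := by
  have hm := measurePreserving_eval_infinitePi (fun _ : ℕ => gaussianReal 0 1) i
  have : HasSubgaussianMGF id 1 (gaussianReal 0 1) :=
    ⟨fun t => integrable_exp_mul_gaussianReal t, fun t => by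
      rw [mgf_gaussianReal (μ := 0) (v := 1) (by simp)]; simp⟩
  rw [← hm.map_eq] at this
  exact this.of_map hm.measurable.aemeasurable

lemma iIndepFun_eval : iIndepFun (fun (i : ℕ) (ξ : ℕ → ℝ) => ξ i) stdNormalSeq :=
  iIndepFun_infinitePi (P := fun _ : ℕ => gaussianReal 0 1) (X := fun _ x => x) (by fun_prop)

/-- By independence the variance proxies add up: `2 ^ k` terms, each at most `(2 ^ (-k)) ^ 2`. -/
lemma hasSubgaussianMGF_blockSum (k : ℕ) (θ : ℝ) :
    HasSubgaussianMGF (fun ξ => blockSum k ξ θ) ((1 / 2) ^ k) stdNormalSeq := by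
  have hind : iIndepFun (fun (i : ℕ) (ξ : ℕ → ℝ) => mode i θ * ξ i) stdNormalSeq :=
    iIndepFun_eval.comp (fun i x => mode i θ * x) fun i => by fun_prop
  refine hasSubgaussianMGF_mono (HasSubgaussianMGF.sum_of_iIndepFun hind
    (s := dyadicBlock k) fun i _ => (hasSubgaussianMGF_eval i).const_mul (mode i θ)) ?_
  rw [← NNReal.coe_le_coe]
  push_cast
  calc _ ≤ ∑ i ∈ dyadicBlock k, (1 / 2 ^ k : ℝ) ^ 2 := by
        refine Finset.sum_le_sum fun i hi => ?_
        have h1 : |mode i θ| ≤ 1 / 2 ^ k := (abs_mode_le i θ).trans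
          (one_div_le_one_div_of_le (by positivity) (le_of_mem_dyadicBlock hi))
        have := pow_le_pow_left₀ (abs_nonneg _) h1 2
        rw [sq_abs] at this
        change mode i θ ^ 2 * 1 ≤ _
        rwa [mul_one]
    _ = (1 / 2) ^ k := by
        rw [Finset.sum_const, card_dyadicBlock, nsmul_eq_mul, one_div_pow]
        push_cast
        rw [one_div_pow]
        field_simp

lemma measureReal_abs_gt_le {Ω : Type*} {mΩ : MeasurableSpace Ω} {μ : Measure Ω}
    [IsFiniteMeasure μ] {X : Ω → ℝ} {v : NNReal} (h : HasSubgaussianMGF X v μ) {t : ℝ}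
    (ht : 0 ≤ t) : μ.real {ω | t < |X ω|} ≤ 2 * Real.exp (-t ^ 2 / (2 * v)) := by
  have h1 := h.measure_ge_le ht
  have h2 := h.neg.measure_ge_le ht
  refine (measureReal_mono (s₂ := {ω | t ≤ X ω} ∪ {ω | t ≤ (-X) ω}) fun ω hω => ?_).trans
    ((measureReal_union_le _ _).trans (by linarith))
  rcases lt_abs.1 (show t < |X ω| from hω) with h | h
  · exact Or.inl h.le
  · exact Or.inr h.le

/-- Union bound over grid points and coefficients. At threshold `(9/10) ^ k` and variance proxy `2 ^
(-k)` the exponent is `(81/50) ^ k / 2`, which grows. -/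
lemma measureReal_goodBlock_compl_le (k : ℕ) :
    stdNormalSeq.real (goodBlock k)ᶜ ≤ 15360 * (8 / 11) ^ k + 4 * (1 / 2) ^ k := by
  have hexp : ∀ (n : ℕ) {y : ℝ}, 0 < y → Real.exp (-y) ≤ n.factorial / y ^ n := fun n y hy => by
    rw [Real.exp_neg, inv_le_comm₀ (Real.exp_pos _) (by positivity), inv_div]
    exact Real.pow_div_factorial_le_exp y hy.le n
  have hgrid : ∀ θ, stdNormalSeq.real {ξ | (9 / 10) ^ k < |blockSum k ξ θ|}
      ≤ 7680 * (1 / 11) ^ k := fun θ => by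
    refine (measureReal_abs_gt_le (hasSubgaussianMGF_blockSum k θ) (by positivity)).trans ?_
    have hy : -((9 / 10 : ℝ) ^ k) ^ 2 / (2 * (((1 / 2) ^ k : NNReal) : ℝ))
        = -((81 / 50) ^ k / 2) := by
      have : (81 / 50 : ℝ) ^ k * (1 / 2) ^ k = ((9 / 10 : ℝ) ^ k) ^ 2 := by
        rw [← mul_pow, ← pow_mul, mul_comm k 2, pow_mul]; norm_num
      rw [← this]
      push_cast
      field_simp
    rw [hy]
    -- Power `5` is enough: `(81/50) ^ 5 > 11`, which beats the `8 ^ k + 1` grid points. The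
    -- constant is `7680 = 2 * 5! * 2 ^ 5`.
    have h1 := hexp 5 (y := (81 / 50) ^ k / 2) (by positivity)
    have h2 : ((11 : ℝ)) ^ k ≤ ((81 / 50) ^ k) ^ 5 := by
      rw [← pow_mul, mul_comm k 5, pow_mul]
      exact pow_le_pow_left₀ (by norm_num) (by norm_num) k
    calc _ ≤ 2 * (((5).factorial : ℝ) / ((81 / 50) ^ k / 2) ^ 5) := by gcongr
      _ = 7680 * (1 / ((81 / 50) ^ k) ^ 5) := by
        rw [show Nat.factorial 5 = 120 from rfl]; push_cast; field_simp; norm_num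
      _ ≤ 7680 * (1 / 11 ^ k) := by gcongr
      _ = _ := by rw [one_div_pow]
  have hcoord : ∀ i, stdNormalSeq.real {ξ | 2 ^ k < |ξ i|} ≤ 4 * (1 / 4) ^ k := fun i => by
    refine (measureReal_abs_gt_le (hasSubgaussianMGF_eval i) (by positivity)).trans ?_
    have h4 : ((2 : ℝ) ^ k) ^ 2 = 4 ^ k := by rw [← pow_mul, mul_comm, pow_mul]; norm_num
    have h1 := hexp 1 (y := (4 : ℝ) ^ k / 2) (by positivity)
    rw [h4, NNReal.coe_one, mul_one, neg_div]
    calc _ ≤ 2 * (((1).factorial : ℝ) / (4 ^ k / 2) ^ 1) := by gcongr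
      _ = _ := by simp; ring
  have hsub : (goodBlock k)ᶜ ⊆
      (⋃ j ∈ Finset.range (8 ^ k + 1), {ξ | (9 / 10) ^ k < |blockSum k ξ (j / 8 ^ k)|}) ∪
        ⋃ i ∈ dyadicBlock k, {ξ : ℕ → ℝ | 2 ^ k < |ξ i|} := fun ξ hξ => by
    by_contra hcon
    rw [Set.mem_union, not_or] at hcon
    simp only [Set.mem_iUnion, Set.mem_ofPred_eq, not_exists, not_lt] at hcon
    exact hξ ⟨hcon.1, hcon.2⟩
  refine (measureReal_mono hsub).trans ((measureReal_union_le _ _).trans (add_le_add ?_ ?_))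
  · refine (measureReal_biUnion_finset_le _ _).trans ?_
    refine (Finset.sum_le_sum fun j _ => hgrid _).trans ?_
    rw [Finset.sum_const, Finset.card_range, nsmul_eq_mul]
    have h8 : (1 : ℝ) ≤ 8 ^ k := one_le_pow₀ (by norm_num)
    push_cast
    calc ((8 : ℝ) ^ k + 1) * (7680 * (1 / 11) ^ k) ≤ (8 ^ k + 8 ^ k) * (7680 * (1 / 11) ^ k) := by
          gcongr
      _ = 15360 * (8 ^ k * (1 / 11) ^ k) := by ring
      _ = _ := by rw [← mul_pow]; norm_num
  · refine (measureReal_biUnion_finset_le _ _).trans ?_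
    refine (Finset.sum_le_sum fun i _ => hcoord i).trans_eq ?_
    rw [Finset.sum_const, card_dyadicBlock, nsmul_eq_mul]
    push_cast
    rw [mul_left_comm, ← mul_pow]; norm_num

lemma measurableSet_goodBlock_pi (k : ℕ) : MeasurableSet (goodBlock k) :=
  measurableSet_goodBlock (Ω := ℕ → ℝ) (X := fun i ξ => ξ i) fun i _ => measurable_pi_apply i

lemma exists_goodBlock_tail {δ : ℝ} (hδ : 0 < δ) :
    ∃ m, stdNormalSeq (⋂ k, goodBlock (k + m)) ≠ 0 ∧
      ∀ L, m ≤ L → ∑ k ∈ Finset.Ico m L, ((9 / 10 : ℝ) ^ k + 2 * (1 / 2) ^ k) ≤ δ := by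
  set q : ℕ → ℝ := fun k => 15360 * (8 / 11) ^ k + 4 * (1 / 2) ^ k with hq
  set b : ℕ → ℝ := fun k => (9 / 10) ^ k + 2 * (1 / 2) ^ k with hb
  have hqs : Summable q :=
    ((summable_geometric_of_lt_one (by norm_num) (by norm_num)).mul_left _).add
      ((summable_geometric_of_lt_one (by norm_num) (by norm_num)).mul_left _)
  have hbs : Summable b :=
    (summable_geometric_of_lt_one (by norm_num) (by norm_num)).add
      ((summable_geometric_of_lt_one (by norm_num) (by norm_num)).mul_left _)
  have hq0 : ∀ k, 0 ≤ q k := fun k => by positivity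
  have hb0 : ∀ k, 0 ≤ b k := fun k => by positivity
  -- Both tails are made small at once: failure probabilities summing to less than `1` leave the
  -- good event with positive probability, and the block bounds sum to less than `δ`.
  obtain ⟨m, hm1, hm2⟩ := (((tendsto_sum_nat_add q).eventually_lt_const one_pos).and
    ((tendsto_sum_nat_add b).eventually_lt_const hδ)).exists
  refine ⟨m, fun h0 => ?_, fun L hL => ?_⟩
  · have h1 : stdNormalSeq (⋂ k, goodBlock (k + m))ᶜ = 1 := by
      rw [prob_compl_eq_one_iff (MeasurableSet.iInter fun k => measurableSet_goodBlock_pi _), h0]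
    have h2 : stdNormalSeq (⋂ k, goodBlock (k + m))ᶜ < 1 := by
      rw [Set.compl_iInter]
      calc _ ≤ ∑' k, stdNormalSeq (goodBlock (k + m))ᶜ := measure_iUnion_le _
        _ ≤ ∑' k, ENNReal.ofReal (q (k + m)) := by
            refine ENNReal.tsum_le_tsum fun k => ?_
            rw [← ofReal_measureReal]
            exact ENNReal.ofReal_le_ofReal (measureReal_goodBlock_compl_le _)
        _ = ENNReal.ofReal (∑' k, q (k + m)) :=
            (ENNReal.ofReal_tsum_of_nonneg (fun k => hq0 _) ((summable_nat_add_iff m).2 hqs)).symm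
        _ < 1 := by rwa [← ENNReal.ofReal_one, ENNReal.ofReal_lt_ofReal_iff one_pos]
    exact h2.ne h1
  · rw [Finset.sum_Ico_eq_sum_range]
    refine le_trans ?_ hm2.le
    simp_rw [add_comm m]
    exact ((summable_nat_add_iff m).2 hbs).sum_le_tsum _ fun k _ => hb0 _

lemma gaussianReal_Icc_pos {η : ℝ} (hη : 0 < η) :
    gaussianReal 0 1 {x | |x| ≤ η} ≠ 0 := by
  intro h0
  have h1 := (gaussianReal_absolutelyContinuous' 0 (v := 1) one_ne_zero) h0
  have h2 : Set.Icc (-η) η ⊆ {x | |x| ≤ η} := fun x hx => abs_le.2 hx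
  have h3 := measure_mono_null h2 h1
  rw [Real.volume_Icc, ENNReal.ofReal_eq_zero] at h3
  linarith

lemma stdNormalSeq_head_pos (N : ℕ) {η : ℝ} (hη : 0 < η) :
    stdNormalSeq (⋂ i ∈ Finset.range N, {ξ | |ξ i| ≤ η}) ≠ 0 := by
  have h1 : (⋂ i ∈ Finset.range N, {ξ : ℕ → ℝ | |ξ i| ≤ η})
      = (Finset.range N : Set ℕ).pi fun _ => {x : ℝ | |x| ≤ η} := by
    ext ξ; simp [Set.mem_pi]
  rw [h1, stdNormalSeq, Measure.infinitePi_pi _ fun i _ =>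
    measurableSet_le continuous_abs.measurable measurable_const, Finset.prod_ne_zero_iff]
  exact fun i _ => gaussianReal_Icc_pos hη

/-- The blocks `k ≥ m` involve only the indices at least `2 ^ m - 1`, so the two events depend on
disjoint sets of independent coordinates. -/
lemma stdNormalSeq_head_inter_tail (m : ℕ) (η : ℝ) :
    stdNormalSeq ((⋂ i ∈ Finset.range (2 ^ m - 1), {ξ | |ξ i| ≤ η}) ∩ ⋂ k, goodBlock (k + m)) =
      stdNormalSeq (⋂ i ∈ Finset.range (2 ^ m - 1), {ξ | |ξ i| ≤ η}) *
        stdNormalSeq (⋂ k, goodBlock (k + m)) := by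
  have hind := indep_iSup_of_disjoint (fun i => (measurable_pi_apply i).comap_le)
    ((iIndepFun_iff_iIndep _ _ _).1 iIndepFun_eval)
    (S := Set.Iio (2 ^ m - 1)) (T := Set.Ici (2 ^ m - 1))
    (Set.disjoint_left.2 fun i hi hi' => (not_le.2 (Set.mem_Iio.1 hi)) (Set.mem_Ici.1 hi'))
  have hcoord : ∀ (S : Set ℕ) (i : ℕ), i ∈ S →
      Measurable[⨆ j ∈ S, MeasurableSpace.comap (fun ξ : ℕ → ℝ => ξ j) inferInstance]
        fun ξ : ℕ → ℝ => ξ i := fun S i hi =>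
    measurable_iff_comap_le.2 (le_iSup₂_of_le i hi le_rfl)
  refine (Indep_iff _ _ _).1 hind _ _ ?_ ?_
  · refine Finset.measurableSet_biInter _ fun i hi => ?_
    exact (continuous_abs.measurable.comp
      (hcoord (Set.Iio (2 ^ m - 1)) i (Finset.mem_range.1 hi))) (measurableSet_Iic (a := η))
  · refine MeasurableSet.iInter fun k => ?_
    refine measurableSet_goodBlock (Ω := ℕ → ℝ) (X := fun i ξ => ξ i) fun i hi => hcoord _ i ?_
    refine le_trans ?_ (Finset.mem_Ico.1 hi).1
    exact Nat.sub_le_sub_right (Nat.pow_le_pow_right two_pos (Nat.le_add_left m k)) 1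

lemma coeFn_gaussianPartial (c : ℝ) (N : ℕ) (ξ : ℕ → ℝ) :
    ∀ᵐ θ ∂leb, gaussianPartial c N ξ θ = c + ∑ i ∈ Finset.range N, mode i θ * ξ i := by
  induction N with
  | zero =>
    filter_upwards [Lp.coeFn_smul c (e 0), (memLp_eFun 0).coeFn_toLp] with θ h1 h2
    simp only [gaussianPartial, Finset.range_zero, Finset.sum_empty, add_zero]
    rw [h1, Pi.smul_apply, e, h2]
    simp [eFun]
  | succ N ih =>
    have hsucc : gaussianPartial c (N + 1) ξ
        = gaussianPartial c N ξ + (ξ N / ((N + 1 : ℝ) * Real.pi)) • e (N + 1) := by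
      simp only [gaussianPartial, Finset.sum_range_succ, add_assoc]
    rw [hsucc]
    filter_upwards [ih, Lp.coeFn_add (gaussianPartial c N ξ)
      ((ξ N / ((N + 1 : ℝ) * Real.pi)) • e (N + 1)),
      Lp.coeFn_smul (ξ N / ((N + 1 : ℝ) * Real.pi)) (e (N + 1)),
      (memLp_eFun (N + 1)).coeFn_toLp] with θ h0 h1 h2 h3
    rw [h1, Pi.add_apply, h0, h2, Pi.smul_apply, e, h3, Finset.sum_range_succ, mode, smul_eq_mul]
    ring

lemma isClosed_band (c δ : ℝ) : IsClosed {x : L2 | ∀ᵐ θ ∂leb, |x θ - c| ≤ δ} := by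
  refine IsSeqClosed.isClosed fun u x hu hx => ?_
  obtain ⟨φ, -, hφ⟩ := (tendstoInMeasure_of_tendsto_Lp hx).exists_seq_tendsto_ae
  filter_upwards [hφ, ae_all_iff.2 fun n => hu (φ n)] with θ h1 h2
  exact le_of_tendsto' ((h1.sub_const c).abs) h2

/-- The Gaussian measure `μ_c` charges every uniform neighbourhood of the constant `c`. -/
theorem mu_band_pos (c : ℝ) {δ : ℝ} (hδ : 0 < δ) :
    0 < mu c {x : L2 | ∀ᵐ θ ∂leb, |x θ - c| ≤ δ} := by
  obtain ⟨m, hm, htail⟩ := exists_goodBlock_tail (half_pos hδ)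
  set N := 2 ^ m - 1 with hN
  -- The `N` low modes are bounded by `1`, so together they contribute at most `N * η ≤ δ / 2`; the
  -- `+ 1` covers `N = 0`.
  set η : ℝ := δ / 2 / (N + 1) with hη
  have hη0 : 0 < η := by positivity
  rw [mu, Measure.map_apply_of_aemeasurable (aemeasurable_gaussianSeries c)
    (isClosed_band c δ).measurableSet, pos_iff_ne_zero]
  refine fun h0 => mul_ne_zero (stdNormalSeq_head_pos N hη0) hm ?_
  rw [← stdNormalSeq_head_inter_tail]
  refine le_antisymm ((measure_mono_ae ?_).trans_eq h0) zero_le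
  filter_upwards [ae_tendsto_gaussianPartial c] with ξ hξ hmem
  have hhead : ∀ i < N, |ξ i| ≤ η := by simpa using Set.mem_iInter₂.1 hmem.1
  have hgood : ∀ k, m ≤ k → ξ ∈ goodBlock k := fun k hk => by
    have := Set.mem_iInter.1 hmem.2 (k - m)
    rwa [Nat.sub_add_cancel hk] at this
  have hsub : Tendsto (fun L => 2 ^ L - 1 : ℕ → ℕ) atTop atTop := by
    refine tendsto_atTop_mono (fun L => ?_) tendsto_id
    exact Nat.le_sub_one_of_lt L.lt_two_pow_self
  -- Only the partial sums ending with a complete dyadic block are needed, as the band is closed in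
  -- `L²`.
  refine (isClosed_band c δ).mem_of_tendsto (hξ.comp hsub) ?_
  filter_upwards [eventually_ge_atTop m] with L hL
  filter_upwards [coeFn_gaussianPartial c (2 ^ L - 1) ξ, ae_restrict_mem measurableSet_Ioo]
    with θ h1 h2
  rw [Function.comp_apply, h1, add_sub_cancel_left, sum_range_eq_add_sum_blockSum ξ θ hL]
  have hA : |∑ i ∈ Finset.range N, mode i θ * ξ i| ≤ δ / 2 := by
    calc _ ≤ ∑ i ∈ Finset.range N, |mode i θ * ξ i| := Finset.abs_sum_le_sum_abs _ _
      _ ≤ ∑ i ∈ Finset.range N, η := by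
          refine Finset.sum_le_sum fun i hi => ?_
          rw [abs_mul]
          refine (mul_le_of_le_one_left (abs_nonneg _) ((abs_mode_le i θ).trans ?_)).trans
            (hhead i (Finset.mem_range.1 hi))
          exact div_le_one_of_le₀ (by linarith [(Nat.cast_nonneg i : (0 : ℝ) ≤ i)]) (by positivity)
      _ = N * (δ / 2 / (N + 1)) := by rw [Finset.sum_const, Finset.card_range, nsmul_eq_mul]
      _ ≤ (N + 1) * (δ / 2 / (N + 1)) := by gcongr; linarith
      _ = δ / 2 := mul_div_cancel₀ _ (by positivity)
  have hB : |∑ k ∈ Finset.Ico m L, blockSum k ξ θ| ≤ δ / 2 :=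
    (Finset.abs_sum_le_sum_abs _ _).trans <| (Finset.sum_le_sum fun k hk =>
      abs_blockSum_le (hgood k (Finset.mem_Ico.1 hk).1) ⟨h2.1.le, h2.2.le⟩).trans (htail L hL)
  exact (abs_add_le _ _).trans (by linarith)

/-! ### Normalization and weak convergence of the Gibbs measures. -/

lemma isProbabilityMeasure_normalized {μ : Measure L2} {ρ : L2 → ℝ≥0∞} (h0 : ∫⁻ x, ρ x ∂μ ≠ 0)
    (h1 : ∫⁻ x, ρ x ∂μ ≠ ∞) : IsProbabilityMeasure (normalized μ ρ) := by
  constructor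
  rw [normalized, Measure.smul_apply, withDensity_apply _ MeasurableSet.univ,
    Measure.restrict_univ, smul_eq_mul, ENNReal.inv_mul_cancel h0 h1]

lemma lintegral_normalized {μ : Measure L2} {ρ f : L2 → ℝ≥0∞} (hρ : Measurable ρ)
    (hf : Measurable f) :
    ∫⁻ x, f x ∂normalized μ ρ = (∫⁻ x, ρ x ∂μ)⁻¹ * ∫⁻ x, ρ x * f x ∂μ := by
  rw [normalized, lintegral_smul_measure, lintegral_withDensity_eq_lintegral_mul _ hρ hf]
  rfl

namespace IsRegularization

/-- `F` may be infinite at `0`, but it is bounded on a compact subset of `(0,∞)`, which makes `U`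
finite. -/
lemma density_pos (h : IsRegularization Fn F A C D r) {a b : ℝ} (ha : 0 < a) {x : L2}
    (hx : ∀ᵐ θ ∂leb, x θ ∈ Set.Icc a b) :
    0 < K.indicator (fun x => EReal.exp (-U F x)) x := by
  obtain ⟨g, hg, hFg⟩ := h.finite_of_pos
  have hK : x ∈ K := hx.mono fun θ hθ => ha.le.trans hθ.1
  obtain ⟨B, hB⟩ := (isCompact_Icc (a := a) (b := b)).exists_bound_of_continuousOn
    (hg.mono fun y hy => ha.trans_le hy.1)
  have hfin : ∫⁻ θ, (F (x θ)).abs ∂leb < ∞ := by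
    refine (lintegral_mono_ae (g := fun _ => ENNReal.ofReal B) ?_).trans_lt (by simp)
    filter_upwards [hx] with θ hθ
    rw [hFg _ (ha.trans_le hθ.1), EReal.abs_def]
    exact ENNReal.ofReal_le_ofReal (hB _ hθ)
  rw [Set.indicator_of_mem hK, U, if_pos ⟨hK, hfin⟩, ← EReal.coe_neg, EReal.exp_coe]
  exact ENNReal.ofReal_pos.2 (Real.exp_pos _)

theorem tendsto_nuN (h : IsRegularization Fn F A C D r) {c : ℝ} (hc : 0 < c) :
    ∃ (hn : ∀ n : ℕ, IsProbabilityMeasure (nuN (Fn n) c)) (h : IsProbabilityMeasure (nu F c)),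
      Tendsto (β := ProbabilityMeasure L2) (fun n : ℕ => ⟨nuN (Fn n) c, hn n⟩) atTop
        (nhds (X := ProbabilityMeasure L2) ⟨nu F c, h⟩) := by
  set ρn : ℕ → L2 → ℝ≥0∞ := fun n x => ENNReal.ofReal (Real.exp (-Un (Fn n) x)) with hρn
  set ρ : L2 → ℝ≥0∞ := K.indicator fun x => EReal.exp (-U F x) with hρ
  have hmn : ∀ n, Measurable (ρn n) := fun n => by
    obtain ⟨B, hB⟩ := h.growth n
    have := measurable_Un (h.continuous n) hB
    fun_prop
  have hlim : ∀ x, Tendsto (fun n => ρn n x) atTop (𝓝 (ρ x)) := h.tendsto_density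
  have hm : Measurable ρ := measurable_of_tendsto_metrizable hmn (tendsto_pi_nhds.2 hlim)
  -- The lower bound `le_Un` evaluated at mean `c`.
  set M : ℝ≥0∞ := ENNReal.ofReal (Real.exp (A * c + D)) with hM
  have hMtop : M ≠ ∞ := ENNReal.ofReal_ne_top
  have hbound : ∀ n, ∀ᵐ x ∂mu c, ρn n x ≤ M := fun n => by
    filter_upwards [ae_integral_eq c] with x hx
    have := h.le_Un n x
    rw [hx] at this
    exact ENNReal.ofReal_le_ofReal (Real.exp_le_exp.2 (by linarith))
  have hconv : ∀ f : BoundedContinuousFunction L2 NNReal,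
      Tendsto (fun n => ∫⁻ x, ρn n x * f x ∂mu c) atTop (𝓝 (∫⁻ x, ρ x * f x ∂mu c)) := fun f => by
    have hf : Measurable fun x => (f x : ℝ≥0∞) := by
      have := f.continuous.measurable
      fun_prop
    refine tendsto_lintegral_of_dominated_convergence (fun _ => M * (nndist 0 f : ℝ≥0∞))
      (fun n => (hmn n).mul hf) (fun n => ?_) ?_ (ae_of_all _ fun x => ?_)
    · filter_upwards [hbound n] with x hx
      gcongr
      exact f.apply_le_nndist_zero x
    · rw [lintegral_const, measure_univ, mul_one]
      exact ENNReal.mul_ne_top hMtop ENNReal.coe_ne_top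
    · exact ENNReal.Tendsto.mul_const (hlim x) (Or.inr ENNReal.coe_ne_top)
  -- The normalizing constants are the case of the test function `1`.
  have hZ : Tendsto (fun n => ∫⁻ x, ρn n x ∂mu c) atTop (𝓝 (∫⁻ x, ρ x ∂mu c)) := by
    simpa using hconv 1
  have hZn_le : ∀ n, ∫⁻ x, ρn n x ∂mu c ≤ M := fun n => by
    simpa using lintegral_mono_ae (hbound n)
  have hZn_top : ∀ n, ∫⁻ x, ρn n x ∂mu c ≠ ∞ := fun n => ne_top_of_le_ne_top hMtop (hZn_le n)
  have hZ_top : ∫⁻ x, ρ x ∂mu c ≠ ∞ := ne_top_of_le_ne_top hMtop (le_of_tendsto' hZ hZn_le)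
  have hZn_pos : ∀ n, ∫⁻ x, ρn n x ∂mu c ≠ 0 := fun n => by
    rw [Ne, lintegral_eq_zero_iff (hmn n)]
    intro h0
    have : ∀ᵐ x ∂mu c, False := by
      filter_upwards [h0] with x hx
      exact (ENNReal.ofReal_pos.2 (Real.exp_pos _)).ne' hx
    simp [IsProbabilityMeasure.ne_zero] at this
  have hZ_pos : ∫⁻ x, ρ x ∂mu c ≠ 0 := by
    rw [← pos_iff_ne_zero, lintegral_pos_iff_support hm]
    -- Half-width `c / 2` keeps the values in `[c/2, 3c/2]`, away from `0`; this is where `c > 0`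
    -- enters.
    refine (mu_band_pos c (half_pos hc)).trans_le (measure_mono fun x hx => ?_)
    refine (h.density_pos (a := c / 2) (b := c + c / 2) (half_pos hc) ?_).ne'
    filter_upwards [hx] with θ hθ
    have := abs_le.1 hθ
    constructor <;> linarith
  refine ⟨fun n => isProbabilityMeasure_normalized (hZn_pos n) (hZn_top n),
    isProbabilityMeasure_normalized hZ_pos hZ_top, ?_⟩
  refine ProbabilityMeasure.tendsto_iff_forall_lintegral_tendsto.2 fun f => ?_
  have hf : Measurable fun x => (f x : ℝ≥0∞) := by
    have := f.continuous.measurable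
    fun_prop
  change Tendsto (fun n => ∫⁻ x, f x ∂normalized (mu c) (ρn n)) atTop
    (𝓝 (∫⁻ x, f x ∂normalized (mu c) ρ))
  simp_rw [lintegral_normalized (hmn _) hf, lintegral_normalized hm hf]
  refine ENNReal.Tendsto.mul (tendsto_inv_iff.2 hZ) (Or.inl ?_) (hconv f) (Or.inr ?_)
  · exact ENNReal.inv_ne_zero.2 hZ_top
  · exact ENNReal.inv_ne_top.2 hZ_pos

end IsRegularization

/-! ### The logarithmic case. -/

lemma abs_le_one_add_sq (x : ℝ) : |x| ≤ 1 + x ^ 2 := by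
  rw [← sq_abs]; nlinarith [sq_nonneg (|x| - 1)]

/-- The logarithmic potential `y log y - y + 1`. -/
noncomputable def logPotential (y : ℝ) : ℝ := y * Real.log y - y + 1

lemma continuous_logPotential : Continuous logPotential :=
  (Real.continuous_mul_log.sub continuous_id).add continuous_const

lemma logPotential_nonneg {y : ℝ} (hy : 0 < y) : 0 ≤ logPotential y := by
  have h := mul_le_mul_of_nonneg_left (Real.one_sub_inv_le_log_of_pos hy) hy.le
  rw [mul_sub, mul_inv_cancel₀ hy.ne'] at h
  rw [logPotential]
  linarith

lemma logPotential_le {y : ℝ} (hy : 0 < y) : logPotential y ≤ (y - 1) ^ 2 := by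
  have h := mul_le_mul_of_nonneg_left (Real.log_le_sub_one_of_pos hy) hy.le
  rw [logPotential]
  nlinarith

lemma FnLog_of_nonneg (n : ℕ) {x : ℝ} (hx : 0 ≤ x) : FnLog n x = logPotential (x + 1 / n) := by
  rw [FnLog, posPart_of_nonneg hx, logPotential]; ring

lemma FnLog_of_nonpos (n : ℕ) {x : ℝ} (hx : x ≤ 0) :
    FnLog n x = Real.log n * -x + logPotential (1 / n) := by
  rw [FnLog, posPart_of_nonpos hx, logPotential, zero_add, one_div, Real.log_inv]; ring

lemma one_div_natCast_succ_pos (n : ℕ) : (0 : ℝ) < 1 / ((n + 1 : ℕ) : ℝ) := by positivity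

lemma one_div_natCast_succ_le_one (n : ℕ) : 1 / ((n + 1 : ℕ) : ℝ) ≤ 1 :=
  div_le_one_of_le₀ (by norm_cast; omega) (by positivity)

lemma tendsto_one_div_natCast_succ :
    Tendsto (fun n : ℕ => 1 / ((n + 1 : ℕ) : ℝ)) atTop (𝓝 0) := by
  simpa using tendsto_one_div_add_atTop_nhds_zero_nat (𝕜 := ℝ)

lemma FnLog_le_of_nonneg (n : ℕ) {x : ℝ} (hx : 0 ≤ x) : FnLog (n + 1) x ≤ 1 + x ^ 2 := by
  have h0 := one_div_natCast_succ_pos n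
  have h1 := one_div_natCast_succ_le_one n
  rw [FnLog_of_nonneg _ hx]
  refine (logPotential_le (by linarith)).trans ?_
  -- With `y = x + 1/(n+1)`, `(y - 1) ^ 2 = (x - s) ^ 2` for some `s ∈ [0, 1]`, and `x ≥ 0`.
  nlinarith

lemma log_natCast_succ_nonneg (n : ℕ) : 0 ≤ Real.log ((n + 1 : ℕ) : ℝ) :=
  Real.log_natCast_nonneg _

lemma log_mul_negPart_le_FnLog (n : ℕ) (x : ℝ) :
    Real.log ((n + 1 : ℕ) : ℝ) * x⁻ ≤ FnLog (n + 1) x := by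
  have h0 := one_div_natCast_succ_pos n
  rcases le_total 0 x with hx | hx
  · rw [negPart_of_nonneg hx, FnLog_of_nonneg _ hx, mul_zero]
    exact logPotential_nonneg (by linarith)
  · rw [negPart_of_nonpos hx, FnLog_of_nonpos _ hx]
    linarith [logPotential_nonneg h0]

lemma FnLog_nonneg (n : ℕ) (x : ℝ) : 0 ≤ FnLog (n + 1) x :=
  (mul_nonneg (log_natCast_succ_nonneg n) (negPart_nonneg x)).trans (log_mul_negPart_le_FnLog n x)

/-- Here `Fn ≥ 0`, whence `A = D = 0`, and the slope on the negative axis provides the rate `log (n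
+ 1)`. The index `n + 1` stands for the integers at least `1`. -/
theorem isRegularization_FnLog :
    IsRegularization (fun n => FnLog (n + 1)) FLog 0 1 0 fun n => Real.log ((n + 1 : ℕ) : ℝ) where
  continuous n := by
    have hpos : ∀ x : ℝ, x⁺ + 1 / ((n + 1 : ℕ) : ℝ) ≠ 0 := fun x =>
      (add_pos_of_nonneg_of_pos (posPart_nonneg x) (one_div_natCast_succ_pos n)).ne'
    have : Continuous fun x : ℝ => x⁺ := continuous_posPart
    unfold FnLog
    fun_prop (disch := assumption)
  growth n := by
    refine ⟨1 + Real.log ((n + 1 : ℕ) : ℝ), fun x => ?_⟩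
    have hlog := log_natCast_succ_nonneg n
    rw [abs_of_nonneg (FnLog_nonneg n x)]
    rcases le_total 0 x with hx | hx
    · refine (FnLog_le_of_nonneg n hx).trans ?_
      nlinarith [sq_nonneg x]
    · have h0 := one_div_natCast_succ_pos n
      have h1 := one_div_natCast_succ_le_one n
      have h2 := logPotential_le h0
      have h3 := mul_le_mul_of_nonneg_left ((neg_le_abs x).trans (abs_le_one_add_sq x)) hlog
      rw [FnLog_of_nonpos _ hx]
      nlinarith [sq_nonneg x]
  nonneg := le_rfl
  const_nonneg := zero_le_one
  lower n x := by simpa using log_mul_negPart_le_FnLog n x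
  le_rate := log_natCast_succ_nonneg
  tendsto_rate := Real.tendsto_log_atTop.comp
    (tendsto_natCast_atTop_atTop.comp (tendsto_add_atTop_nat 1))
  tendsto_coe x hx := by
    rw [FLog, if_pos hx]
    simp_rw [FnLog_of_nonneg _ hx]
    refine EReal.tendsto_coe.2 ((continuous_logPotential.tendsto x).comp ?_)
    simpa using tendsto_one_div_natCast_succ.const_add x
  dominated n x hx := by
    rw [abs_of_nonneg (FnLog_nonneg n x), one_mul]
    exact (ENNReal.ofReal_le_ofReal (FnLog_le_of_nonneg n hx)).trans le_add_self
  finite_of_pos := ⟨logPotential, continuous_logPotential.continuousOn, fun x hx => by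
    rw [FLog, if_pos hx.le, logPotential]⟩

/-! ### The negative-power case. -/

/-- The antiderivative of `-y ^ (-α)` on `(0,∞)`. -/
noncomputable def powPotential (α y : ℝ) : ℝ :=
  if α = 1 then -Real.log y else y ^ (1 - α) / (α - 1)

lemma FnPow_eq (α : ℝ) (n : ℕ) (x : ℝ) :
    FnPow α n x = powPotential α (x⁺ + 1 / n) + (n : ℝ) ^ α * x⁻ := by
  unfold FnPow powPotential
  split_ifs with h
  · rw [h, Real.rpow_one]
  · rfl

lemma continuousOn_powPotential (α : ℝ) : ContinuousOn (powPotential α) (Set.Ioi 0) := by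
  intro y hy
  have hy' : y ≠ 0 := (Set.mem_Ioi.1 hy).ne'
  refine ContinuousAt.continuousWithinAt ?_
  unfold powPotential
  split_ifs
  · exact (Real.continuousAt_log hy').neg
  · exact (Real.continuousAt_rpow_const _ _ (Or.inl hy')).div_const _

lemma antitoneOn_powPotential (α : ℝ) : AntitoneOn (powPotential α) (Set.Ioi 0) := by
  intro y hy z _ hyz
  have hy0 : 0 < y := hy
  unfold powPotential
  split_ifs with h
  · exact neg_le_neg (Real.log_le_log hy0 hyz)
  · rcases lt_or_gt_of_ne h with h | h
    · exact div_le_div_of_nonpos_of_le (by linarith)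
        (Real.rpow_le_rpow hy0.le hyz (by linarith))
    · exact div_le_div_of_nonneg_right
        (Real.rpow_le_rpow_of_nonpos hy0 hyz (by linarith)) (by linarith)

/-- Convexity: the right-hand side lies above its tangent at `1`, whose slope is `-1` for every `α`.
For `α < 1` this is Bernoulli's inequality for the power `1 - α`. -/
lemma powPotential_ge (α : ℝ) {y : ℝ} (hα : 0 < α) (hy : 0 < y) :
    powPotential α 1 - (y - 1) ≤ powPotential α y := by
  unfold powPotential
  split_ifs with h
  · rw [Real.log_one]
    linarith [Real.log_le_sub_one_of_pos hy]
  · rw [Real.one_rpow]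
    rcases lt_or_gt_of_ne h with h | h
    · have h1 : y ^ (1 - α) ≤ 1 + (1 - α) * (y - 1) := by
        have := rpow_one_add_le_one_add_mul_self (s := y - 1) (by linarith)
          (p := 1 - α) (by linarith) (by linarith)
        simpa using this
      have h2 : 0 < 1 - α := by linarith
      rw [← neg_sub 1 α, div_neg, div_neg, le_neg, neg_sub, sub_neg_eq_add, div_le_iff₀ h2,
        add_mul, one_div_mul_cancel h2.ne']
      linarith
    · have h1 : 1 + (1 - α) * (y - 1) ≤ y ^ (1 - α) := by
        rw [Real.rpow_def_of_pos hy]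
        have h2 := Real.add_one_le_exp (Real.log y * (1 - α))
        nlinarith [Real.log_le_sub_one_of_pos hy]
      have h2 : 0 < α - 1 := by linarith
      rw [le_div_iff₀ h2, sub_mul, one_div_mul_cancel h2.ne']
      linarith

lemma tendsto_powPotential_zero {α : ℝ} (hα : 1 ≤ α) :
    Tendsto (powPotential α) (𝓝[>] 0) atTop := by
  unfold powPotential
  split_ifs with h
  · exact tendsto_neg_atBot_atTop.comp Real.tendsto_log_nhdsGT_zero
  · have h1 : 1 < α := lt_of_le_of_ne hα (Ne.symm h)
    exact (tendsto_rpow_neg_nhdsGT_zero (by linarith)).atTop_div_const (by linarith)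

lemma FPow_of_pos (α : ℝ) {x : ℝ} (hx : 0 < x) : FPow α x = (powPotential α x : EReal) := by
  rw [FPow, if_pos hx, powPotential]

lemma FnPow_of_nonneg (α : ℝ) (n : ℕ) {x : ℝ} (hx : 0 ≤ x) :
    FnPow α n x = powPotential α (x + 1 / n) := by
  rw [FnPow_eq, posPart_of_nonneg hx, negPart_of_nonneg hx, mul_zero, add_zero]

lemma FPow_zero {α : ℝ} (hα : α < 1) : FPow α 0 = 0 := by simp [FPow, hα]

lemma FPow_zero_eq_top {α : ℝ} (hα : 1 ≤ α) : FPow α 0 = ⊤ := by simp [FPow, hα]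

lemma powPotential_nonpos {α y : ℝ} (hα : α < 1) (hy : 0 < y) : powPotential α y ≤ 0 := by
  rw [powPotential, if_neg hα.ne]
  exact div_nonpos_of_nonneg_of_nonpos (Real.rpow_nonneg hy.le _) (by linarith)

/-- The potential is decreasing, so shifting its argument by `1 / (n + 1)` lowers it. -/
lemma FnPow_le_FPow (α : ℝ) (n : ℕ) {x : ℝ} (hx : 0 ≤ x) :
    (FnPow α (n + 1) x : EReal) ≤ FPow α x := by
  have h0 := one_div_natCast_succ_pos n
  rw [FnPow_of_nonneg _ _ hx]
  rcases hx.eq_or_lt with rfl | hx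
  · rcases lt_or_ge α 1 with hα | hα
    · rw [FPow_zero hα]
      exact EReal.coe_nonpos.2 (powPotential_nonpos hα (by linarith))
    · rw [FPow_zero_eq_top hα]
      exact le_top
  · rw [FPow_of_pos α hx, EReal.coe_le_coe_iff]
    exact antitoneOn_powPotential α hx (by simp only [Set.mem_Ioi]; linarith) (by linarith)

lemma powPotential_posPart_ge {α : ℝ} (hα : 0 < α) (n : ℕ) (x : ℝ) :
    powPotential α 1 - x⁺ ≤ powPotential α (x⁺ + 1 / ((n + 1 : ℕ) : ℝ)) := by
  have h0 := one_div_natCast_succ_pos n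
  have h1 := one_div_natCast_succ_le_one n
  have := powPotential_ge α hα (add_pos_of_nonneg_of_pos (posPart_nonneg x) h0)
  linarith

/-- The tangent at `1`, evaluated at `x⁺ + 1/(n+1) ≤ x⁺ + 1`, gives `A = 1` and `D = -powPotential α
1`. The rate `(n + 1) ^ α ≥ 1` dominates `A`. For `dominated`, `Fn` lies between this linear bound
and `F`. -/
theorem isRegularization_FnPow {α : ℝ} (hα : 0 < α) :
    IsRegularization (fun n => FnPow α (n + 1)) (FPow α) 1 (1 + |powPotential α 1|)
      (-powPotential α 1) fun n => ((n + 1 : ℕ) : ℝ) ^ α where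
  continuous n := by
    have hpos : ∀ x : ℝ, 0 < x⁺ + 1 / ((n + 1 : ℕ) : ℝ) := fun x =>
      add_pos_of_nonneg_of_pos (posPart_nonneg x) (one_div_natCast_succ_pos n)
    have h1 := (continuousOn_powPotential α).comp_continuous
      (continuous_posPart.add_const _) hpos
    exact (h1.add (continuous_const.mul continuous_negPart)).congr
      fun x => (FnPow_eq α (n + 1) x).symm
  growth n := by
    set ε : ℝ := 1 / ((n + 1 : ℕ) : ℝ) with hε
    have h0 : 0 < ε := one_div_natCast_succ_pos n
    set R : ℝ := ((n + 1 : ℕ) : ℝ) ^ α with hR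
    have hR0 : 0 ≤ R := by positivity
    refine ⟨|powPotential α ε| + |powPotential α 1| + 1 + R, fun x => ?_⟩
    have hp := posPart_nonneg x
    have hup : powPotential α (x⁺ + ε) ≤ powPotential α ε :=
      antitoneOn_powPotential α h0 (by simp only [Set.mem_Ioi]; linarith) (by linarith)
    have hlo := powPotential_posPart_ge hα n x
    have hpx : x⁺ ≤ |x| := by rw [posPart_def]; exact max_le (le_abs_self x) (abs_nonneg x)
    have hnx : x⁻ ≤ |x| := by rw [negPart_def]; exact max_le (neg_le_abs x) (abs_nonneg x)
    have hsq := abs_le_one_add_sq x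
    have habs : |powPotential α (x⁺ + ε)| ≤ |powPotential α ε| + |powPotential α 1| + |x| := by
      refine abs_le.2 ⟨?_, ?_⟩
      · linarith [neg_abs_le (powPotential α 1), abs_nonneg (powPotential α ε)]
      · linarith [le_abs_self (powPotential α ε), abs_nonneg (powPotential α 1), abs_nonneg x]
    have hRx : R * x⁻ ≤ R * (1 + x ^ 2) := mul_le_mul_of_nonneg_left (hnx.trans hsq) hR0
    have hRn : 0 ≤ R * x⁻ := mul_nonneg hR0 (negPart_nonneg x)
    rw [FnPow_eq]
    refine (abs_add_le _ _).trans ?_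
    rw [abs_of_nonneg hRn]
    nlinarith [sq_nonneg x, abs_nonneg (powPotential α ε), abs_nonneg (powPotential α 1)]
  nonneg := zero_le_one
  const_nonneg := by positivity
  lower n x := by
    rw [FnPow_eq]
    linarith [powPotential_posPart_ge hα n x]
  le_rate n := Real.one_le_rpow (by norm_cast; omega) hα.le
  tendsto_rate := (tendsto_rpow_atTop hα).comp
    (tendsto_natCast_atTop_atTop.comp (tendsto_add_atTop_nat 1))
  tendsto_coe x hx := by
    simp_rw [FnPow_of_nonneg _ _ hx]
    rcases hx.eq_or_lt with rfl | hx
    · have hlim : Tendsto (fun n : ℕ => (0 : ℝ) + 1 / ((n + 1 : ℕ) : ℝ)) atTop (𝓝[>] 0) := by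
        simp_rw [zero_add]
        exact tendsto_nhdsWithin_iff.2 ⟨tendsto_one_div_natCast_succ,
          Eventually.of_forall one_div_natCast_succ_pos⟩
      rcases lt_or_ge α 1 with hα1 | hα1
      · rw [FPow_zero hα1, ← EReal.coe_zero, EReal.tendsto_coe]
        simp_rw [powPotential, if_neg hα1.ne]
        have h1 := ((Real.continuousAt_rpow_const 0 (1 - α) (Or.inr (by linarith))).tendsto.comp
          (hlim.mono_right nhdsWithin_le_nhds)).div_const (α - 1)
        rwa [Real.zero_rpow (by linarith), zero_div] at h1
      · rw [FPow_zero_eq_top hα1]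
        exact EReal.tendsto_coe_nhds_top_iff.2 ((tendsto_powPotential_zero hα1).comp hlim)
    · rw [FPow_of_pos α hx, EReal.tendsto_coe]
      refine ((continuousOn_powPotential α).continuousAt (Ioi_mem_nhds hx)).tendsto.comp ?_
      simpa using tendsto_one_div_natCast_succ.const_add x
  dominated n x hx := by
    have hle := FnPow_le_FPow α n hx
    have hlo := powPotential_posPart_ge hα n x
    rw [posPart_of_nonneg hx, ← FnPow_of_nonneg _ _ hx] at hlo
    have hsq := (le_abs_self x).trans (abs_le_one_add_sq x)
    have h1 := mul_le_mul_of_nonneg_left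
      (le_add_of_nonneg_right (sq_nonneg x) : (1 : ℝ) ≤ 1 + x ^ 2) (abs_nonneg (powPotential α 1))
    induction hF : FPow α x using EReal.rec with
    | bot => rw [hF] at hle; exact absurd (le_bot_iff.1 hle) (EReal.coe_ne_bot _)
    | top => simp
    | coe a =>
      rw [hF, EReal.coe_le_coe_iff] at hle
      rw [EReal.abs_def, ← ENNReal.ofReal_add (abs_nonneg a) (by positivity)]
      refine ENNReal.ofReal_le_ofReal (abs_le.2 ⟨?_, ?_⟩)
      · linarith [neg_abs_le (powPotential α 1), abs_nonneg a]
      · have : 0 ≤ (1 + |powPotential α 1|) * (1 + x ^ 2) := by positivity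
        linarith [le_abs_self a]
  finite_of_pos := ⟨powPotential α, continuousOn_powPotential α, fun _ => FPow_of_pos α⟩

end CahnHilliard

open CahnHilliard
theorem mainTheorem5 (c : ℝ) (hc : 0 < c) :
    (∃ (hn : ∀ n : ℕ, IsProbabilityMeasure (nuN (FnLog (n + 1)) c))
       (h : IsProbabilityMeasure (nu FLog c)),
      Tendsto (β := ProbabilityMeasure L2) (fun n : ℕ => ⟨nuN (FnLog (n + 1)) c, hn n⟩) atTop
        (nhds (X := ProbabilityMeasure L2) ⟨nu FLog c, h⟩)) ∧
    (∀ α : ℝ, 0 < α →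
      ∃ (hn : ∀ n : ℕ, IsProbabilityMeasure (nuN (FnPow α (n + 1)) c))
        (h : IsProbabilityMeasure (nu (FPow α) c)),
        Tendsto (β := ProbabilityMeasure L2) (fun n : ℕ => ⟨nuN (FnPow α (n + 1)) c, hn n⟩) atTop
          (nhds (X := ProbabilityMeasure L2) ⟨nu (FPow α) c, h⟩)) :=
  ⟨isRegularization_FnLog.tendsto_nuN hc, fun _ hα => (isRegularization_FnPow hα).tendsto_nuN hc⟩
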